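/- Let $P$ be a convex polygon with vertex set $V=\{0,1,\dots,n-1\}$ ($n\ge 3$) in its cyclic order, and let $D$ be a dissection of $P$, i.e. a set of pairwise non-crossing internal diagonals. A frieze on $P$ over an integral domain $R$ is a map $f:V\times V\to R$ such that $f(i,j)=0$ if and only if $i=j$, $f(i,i\pm1)=1$, $f(i,j)=f(j,i)$, and $f(i,j)f(k,l)=f(i,l)f(j,k)+f(i,k)f(j,l)$ whenever $(i,j)$ and $(k,l)$ cross. The frieze $f_D$ from the dissection $D$ is the unique real-valued frieze on $P$ whose restriction to each subpolygon of $D$, with $p$ vertices say, is the Euclidean frieze: two vertices in positions $i\le j$ of the $p$-gon get the value $U_{j-i-1}(2\cos(\pi/p))$, where $U_{-1}(x)=0$, $U_0(x)=1$ and $U_k(x)=xU_{k-1}(x)-U_{k-2}(x)$. A frieze over $R$ is unitary if some triangulation of $P$ (a unitary triangulation) consists of arcs whose values are units of $R$. For $m\ge0$, an $m$-tower is a dissection of a $(2m+3)$-gon into one triangle and $m$ quadrilaterals such that no vertex is incident to more than two of these subpolygons. A roof point of a tower is a vertex incident only to the triangle (it is unique if $m\ge1$; if $m=0$ all three vertices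 are roof points), and a tower arc is an arc inside the tower with an endpoint at a roof point. Call a set of arcs $E\subseteq D$ a tower decomposition of $D$ if the restriction of $D$ to each of the subpolygons into which $E$ divides $P$ is a tower; the elements of $E$ are the gluing arcs. Theorem. Suppose that $D$ has a tower decomposition. Then $f_D$ exists, is unique, takes values in $\mathbb{Z}[\sqrt2]$, and is unitary as a frieze over $\mathbb{Z}[\sqrt2]$. More precisely, for every tower decomposition $E$ of $D$, the gluing arcs together with those tower arcs that are internal diagonals of their tower form a unitary triangulation of $P$; every gluing arc has weight $f_D=1$, and every tower arc that crosses exactly $k$ arcs of $D$ (so that it passes through the triangle and $k$ quadrilaterals of its tower) has weight $f_D=(1+\sqrt2)^k$. -/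

import Mathlib

namespace PolygonFrieze

/-- The arcs `(i, j)` and `(k, l)` of the polygon with vertex set `Fin n` (in its cyclic order)
cross: `i, k, j, l` or `i, l, j, k` are in strict cyclic order. -/
def Crosses {n : ℕ} (i j k l : Fin n) : Prop :=
  (sbtw i k j ∧ sbtw j l i) ∨ (sbtw i l j ∧ sbtw j k i)

/-! ### Friezes on a polygon -/

/-- A frieze on the `n`-gon with values in the integral domain `R`. -/
structure IsFrieze {n : ℕ} [NeZero n] {R : Type*} [CommRing R] [IsDomain R]
    (f : Fin n → Fin n → R) : Prop where
  eq_zero_iff : ∀ i j, f i j = 0 ↔ i = j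
  boundary_succ : ∀ i, f i (i + 1) = 1
  boundary_pred : ∀ i, f i (i - 1) = 1
  symm : ∀ i j, f i j = f j i
  ptolemy : ∀ i j k l, Crosses i j k l → f i j * f k l = f i l * f j k + f i k * f j l

/-! ### Subpolygons and dissections -/

/-- `(i, j)` is an internal diagonal of the subpolygon with vertex set `S`. -/
def IsDiagonal {n : ℕ} (S : Finset (Fin n)) (i j : Fin n) : Prop :=
  i ∈ S ∧ j ∈ S ∧ ∃ k ∈ S, ∃ l ∈ S, Crosses i j k l

/-- `(i, j)` is a side (boundary arc) of the subpolygon with vertex set `S`. -/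
def IsSide {n : ℕ} (S : Finset (Fin n)) (i j : Fin n) : Prop :=
  i ∈ S ∧ j ∈ S ∧ i ≠ j ∧ ∀ k ∈ S, ∀ l ∈ S, ¬ Crosses i j k l

/-- A set of arcs of the `n`-gon is a set of unordered pairs of distinct vertices, that is, a simple
graph on `Fin n`.  It is a dissection if it consists of pairwise non-crossing internal diagonals. -/
def IsDissection {n : ℕ} (D : SimpleGraph (Fin n)) : Prop :=
  (∀ i j, D.Adj i j → IsDiagonal Finset.univ i j) ∧
    ∀ i j k l, D.Adj i j → D.Adj k l → ¬ Crosses i j k l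

/-- The subpolygon with vertex set `R` is one of the subpolygons into which the arcs of `D` that are
diagonals of `Q` divide the subpolygon with vertex set `Q`: every side of `R` is a side of `Q` or an
arc of `D`, and no arc of `D` is a diagonal of `R`. -/
structure IsPiece {n : ℕ} (D : SimpleGraph (Fin n)) (Q R : Finset (Fin n)) : Prop where
  subset : R ⊆ Q
  three_le_card : 3 ≤ R.card
  side : ∀ i j, IsSide R i j → IsSide Q i j ∨ D.Adj i j
  not_adj : ∀ i j, IsDiagonal R i j → ¬ D.Adj i j

/-- A triangulation: a dissection that divides the polygon into triangles. -/
def IsTriangulation {n : ℕ} (T : SimpleGraph (Fin n)) : Prop :=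
  IsDissection T ∧ ∀ R, IsPiece T Finset.univ R → R.card = 3

/-! ### Unitary friezes -/

/-- `T` is a triangulation all of whose arcs have unit weight under `f`. -/
def IsUnitaryTriangulation {n : ℕ} {R : Type*} [CommRing R]
    (f : Fin n → Fin n → R) (T : SimpleGraph (Fin n)) : Prop :=
  IsTriangulation T ∧ ∀ i j, T.Adj i j → IsUnit (f i j)

def IsUnitary {n : ℕ} {R : Type*} [CommRing R] (f : Fin n → Fin n → R) : Prop :=
  ∃ T, IsUnitaryTriangulation f T

/-! ### The frieze from a dissection -/

/-- The value `U_{d - 1}(2 cos (π / p))` of the Euclidean frieze on a `p`-gon at two vertices at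
distance `d`.  `Polynomial.Chebyshev.S` is the normalized Chebyshev polynomial of the second kind:
`S (-1) = 0`, `S 0 = 1` and `S (k + 2) = X * S (k + 1) - S k`. -/
noncomputable def euclideanWeight (p d : ℕ) : ℝ :=
  (Polynomial.Chebyshev.S ℝ ((d : ℤ) - 1)).eval (2 * Real.cos (Real.pi / p))

/-- `f` is the frieze from the dissection `D`: a frieze that restricts on each subpolygon `S` of `D`
to the Euclidean frieze of the `S.card`-gon.  For `i ≤ j` in `S`, the number of elements of `S`
in `[i, j)` is the difference of the positions of `j` and `i` among the vertices of `S`. -/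
def IsFriezeFromDissection {n : ℕ} [NeZero n] (D : SimpleGraph (Fin n))
    (f : Fin n → Fin n → ℝ) : Prop :=
  IsFrieze f ∧ ∀ S, IsPiece D Finset.univ S → ∀ i ∈ S, ∀ j ∈ S, i ≤ j →
    f i j = euclideanWeight S.card (S.filter fun v => i ≤ v ∧ v < j).card

/-- The inclusion of `ℤ[√2]` in `ℝ`. -/
noncomputable def sqrtTwoToReal : ℤ√2 →+* ℝ := Zsqrtd.toReal (by norm_num)

theorem sqrtTwoToReal_injective : Function.Injective sqrtTwoToReal := by
  refine Zsqrtd.toReal_injective _ fun m h => ?_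
  have h1 : m ≤ 1 := by nlinarith
  have h2 : -1 ≤ m := by nlinarith
  interval_cases m <;> omega

instance : IsDomain (ℤ√2) := sqrtTwoToReal_injective.isDomain sqrtTwoToReal

/-! ### Towers -/

/-- The restriction of `D` to the subpolygon with vertex set `Q` is an `m`-tower: `Q` is a
`(2m + 3)`-gon, divided by `D` into exactly one triangle and `m` quadrilaterals, and no vertex is
incident to more than two of these subpolygons. -/
structure IsTower {n : ℕ} (D : SimpleGraph (Fin n)) (Q : Finset (Fin n)) (m : ℕ) : Prop where
  card_eq : Q.card = 2 * m + 3
  card_piece : ∀ R, IsPiece D Q R → R.card = 3 ∨ R.card = 4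
  triangle : {R | IsPiece D Q R ∧ R.card = 3}.ncard = 1
  quadrilaterals : {R | IsPiece D Q R ∧ R.card = 4}.ncard = m
  incident : ∀ v, {R | IsPiece D Q R ∧ v ∈ R}.ncard ≤ 2

/-- `v` is a roof point of the tower `Q`: a vertex of `Q` incident only to the triangle.  It is
unique unless the tower is a single triangle, in which case all three vertices qualify. -/
def IsRoofPoint {n : ℕ} (D : SimpleGraph (Fin n)) (Q : Finset (Fin n)) (v : Fin n) : Prop :=
  v ∈ Q ∧ ∀ R, IsPiece D Q R → v ∈ R → R.card = 3

/-- The set `E` of gluing arcs, a subset of the dissection `D`, decomposes the polygon into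
subpolygons to each of which `D` restricts to a tower. -/
def IsTowerDecomposition {n : ℕ} (D E : SimpleGraph (Fin n)) : Prop :=
  E ≤ D ∧ ∀ Q, IsPiece E Finset.univ Q → ∃ m, IsTower D Q m

/-- `D` is a gluing of towers. -/
def DecomposesIntoTowers {n : ℕ} (D : SimpleGraph (Fin n)) : Prop :=
  ∃ E, IsTowerDecomposition D E

/-- The gluing arcs together with the (internal) tower arcs at the roof points of the towers. -/
def towerTriangulation {n : ℕ} (D E : SimpleGraph (Fin n)) : SimpleGraph (Fin n) :=
  SimpleGraph.fromRel fun a b =>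
    E.Adj a b ∨ ∃ Q, IsPiece E Finset.univ Q ∧ IsRoofPoint D Q a ∧ IsDiagonal Q a b

/-- The number of arcs of `D` crossed by the arc `(a, b)`. -/
noncomputable def crossingNumber {n : ℕ} (D : SimpleGraph (Fin n)) (a b : Fin n) : ℕ :=
  {e : Fin n × Fin n | e.1 < e.2 ∧ D.Adj e.1 e.2 ∧ Crosses a b e.1 e.2}.ncard

end PolygonFrieze

open PolygonFrieze

namespace PolygonFrieze

/-! ### Crossing chords in cyclic order -/

section Crossing

variable {n : ℕ} {a b c d i j k l r s t u v w x y z : Fin n}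

/-! The frieze is built from plane vectors: attach to each vertex `i` a vector in `ℤ[√2]²` and let
the value at `i < j` be a determinant. Ptolemy's relation is then the Plücker identity. In a gluing
of towers every piece of `D` is a triangle or a quadrilateral, whose Euclidean values are 0, 1 and
`√2`, so explicit vectors exist for each piece. Two families along a common arc of `D`, which has
weight 1, are glued by a unimodular change of basis (`IsModel.glue`). Positivity of all determinants
survives gluing and gives nonvanishing. Uniqueness (`IsFriezeFromDissection.eqOn`) follows by
cutting along an arc of `D`: Ptolemy expresses a value across the cut through values in the two
halves.

For a tower with roof `r`, peel off a last quadrilateral, cut off by an arc `(a, b)` of `D`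
(`IsRoofed.weights`). If `r` has weight `λ ^ k` to both `a` and `b`, with `λ = 1 + √2`, Ptolemy
gives each of the two new vertices weight `λ ^ k * (1 + √2) = λ ^ (k + 1)`, and the arc from `r`
crosses one more arc of `D`. The bound of two pieces per vertex ensures that `a` and `b` have the
same `k`.

Gluing arcs have weight 1 and `λ` is a unit. The gluing arcs together with the fan from each roof
form a triangulation: a piece of it contains the roof of its tower, is joined to it by sides only,
and a vertex has at most two sides. -/

theorem crosses_of_lt (h : i < j) : Crosses i j k l ↔
    (i < k ∧ k < j ∧ (l < i ∨ j < l)) ∨ (i < l ∧ l < j ∧ (k < i ∨ j < k)) := by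
  unfold Crosses
  simp only [sbtw]
  omega

theorem crosses_of_gt (h : j < i) : Crosses i j k l ↔
    (j < k ∧ k < i ∧ (l < j ∨ i < l)) ∨ (j < l ∧ l < i ∧ (k < j ∨ i < k)) := by
  unfold Crosses
  simp only [sbtw]
  omega

theorem Crosses.ne (h : Crosses i j k l) :
    i ≠ j ∧ k ≠ l ∧ i ≠ k ∧ i ≠ l ∧ j ≠ k ∧ j ≠ l := by
  unfold Crosses at h
  simp only [sbtw] at h
  omega

theorem Crosses.swap (h : Crosses i j k l) : Crosses j i k l := by
  rcases lt_or_gt_of_ne h.ne.1 with h1 | h1 <;>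
    simp only [crosses_of_lt, crosses_of_gt, h1] at h ⊢ <;> exact h

theorem Crosses.symm (h : Crosses i j k l) : Crosses k l i j := by
  rcases lt_or_gt_of_ne h.ne.1 with h1 | h1 <;> rcases lt_or_gt_of_ne h.ne.2.1 with h2 | h2 <;>
    simp only [crosses_of_lt, crosses_of_gt, h1, h2] at h ⊢ <;> omega

theorem Crosses.swap_right (h : Crosses i j k l) : Crosses i j l k :=
  h.symm.swap.symm

theorem crosses_swap : Crosses i j k l ↔ Crosses j i k l := ⟨.swap, .swap⟩

theorem crosses_symm : Crosses i j k l ↔ Crosses k l i j := ⟨.symm, .symm⟩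

/-- If `(s, s')` separates `y` from both ends of an arc crossing `(x, y)`, it crosses `(x, y)`. -/
theorem Crosses.of_separates (h : Crosses x y r c) (ht : Crosses s t y u)
    (hr : r = s ∨ r = t ∨ Crosses s t y r) (hc : c = s ∨ c = t ∨ Crosses s t y c) :
    Crosses s t x y := by
  by_contra hn
  rcases lt_or_gt_of_ne h.ne.1 with h1 | h1 <;> rcases lt_or_gt_of_ne ht.ne.1 with h2 | h2 <;>
    simp only [crosses_of_lt, crosses_of_gt, h1, h2] at h hr hc hn ht <;> omega

/-- The chord `(s, t)` leaves `a, b` in the closed half opposite to `y` and `c, d` in the closed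
half of `y`; chords in opposite halves do not cross. -/
theorem not_crosses_of_separated (ht : Crosses s t y u)
    (ha : a = s ∨ a = t ∨ Crosses s t y a) (hb : b = s ∨ b = t ∨ Crosses s t y b)
    (hc : ¬ Crosses s t y c) (hd : ¬ Crosses s t y d) : ¬ Crosses a b c d := by
  intro h
  rcases lt_or_gt_of_ne h.ne.1 with h1 | h1 <;> rcases lt_or_gt_of_ne ht.ne.1 with h2 | h2 <;>
    simp only [crosses_of_lt, crosses_of_gt, h1, h2] at h ha hb hc hd ht <;> omega

theorem Crosses.trans_left (h : Crosses a b k l) (ha : r ≠ a) (hb : r ≠ b) :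
    Crosses a b r k ∨ Crosses a b r l := by
  rcases lt_or_gt_of_ne h.ne.1 with h1 | h1 <;>
    simp only [crosses_of_lt, crosses_of_gt, h1] at h ⊢ <;> omega

/-- Of the three pairings of four distinct points one is a crossing. -/
theorem crosses_of_ne (hab : a ≠ b) (hac : a ≠ c) (had : a ≠ d) (hbc : b ≠ c) (hbd : b ≠ d)
    (hcd : c ≠ d) : Crosses a b c d ∨ Crosses a c b d ∨ Crosses a d b c := by
  rcases lt_or_gt_of_ne hab with h1 | h1 <;> rcases lt_or_gt_of_ne hac with h2 | h2 <;>
    rcases lt_or_gt_of_ne had with h3 | h3 <;>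
    simp only [crosses_of_lt, crosses_of_gt, h1, h2, h3, true_and, and_true, true_or, or_true] <;>
    omega

end Crossing

/-! ### Sides, diagonals and the two halves cut out by an arc -/

section Sides

open Finset

variable {n : ℕ} {S R : Finset (Fin n)} {i j a b r : Fin n} {D : SimpleGraph (Fin n)}

theorem IsSide.symm (h : IsSide S i j) : IsSide S j i :=
  ⟨h.2.1, h.1, h.2.2.1.symm, fun k hk l hl hc => h.2.2.2 k hk l hl hc.swap⟩

theorem IsDiagonal.symm (h : IsDiagonal S i j) : IsDiagonal S j i := by
  obtain ⟨hi, hj, k, hk, l, hl, hc⟩ := h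
  exact ⟨hj, hi, k, hk, l, hl, hc.swap⟩

theorem IsDiagonal.ne (h : IsDiagonal S i j) : i ≠ j := by
  obtain ⟨_, _, k, _, l, _, hc⟩ := h
  exact hc.ne.1

theorem IsSide.not_isDiagonal (h : IsSide S i j) : ¬ IsDiagonal S i j := by
  rintro ⟨_, _, k, hk, l, hl, hc⟩
  exact h.2.2.2 k hk l hl hc

theorem isSide_of_not_isDiagonal (hi : i ∈ S) (hj : j ∈ S) (hij : i ≠ j)
    (h : ¬ IsDiagonal S i j) : IsSide S i j :=
  ⟨hi, hj, hij, fun k hk l hl hc => h ⟨hi, hj, k, hk, l, hl, hc⟩⟩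

theorem IsSide.of_subset (h : IsSide S i j) (hRS : R ⊆ S) (hi : i ∈ R) (hj : j ∈ R) :
    IsSide R i j :=
  ⟨hi, hj, h.2.2.1, fun k hk l hl => h.2.2.2 k (hRS hk) l (hRS hl)⟩

theorem IsDiagonal.mono (h : IsDiagonal R i j) (hRS : R ⊆ S) : IsDiagonal S i j := by
  obtain ⟨hi, hj, k, hk, l, hl, hc⟩ := h
  exact ⟨hRS hi, hRS hj, k, hRS hk, l, hRS hl, hc⟩

/-- In the linear order of `Fin n`, a side joins consecutive elements of `S`, or wraps around from
the least to the greatest. -/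
theorem isSide_iff_of_lt (h : i < j) : IsSide S i j ↔
    i ∈ S ∧ j ∈ S ∧ ((∀ k ∈ S, k ≤ i ∨ j ≤ k) ∨ ∀ k ∈ S, i ≤ k ∧ k ≤ j) := by
  constructor
  · rintro ⟨hi, hj, -, hc⟩
    refine ⟨hi, hj, ?_⟩
    by_contra! hn
    obtain ⟨⟨k, hk, hk1, hk2⟩, l, hl, hl1⟩ := hn
    refine hc k hk l hl ?_
    rw [crosses_of_lt h]
    omega
  · rintro ⟨hi, hj, hc⟩
    refine ⟨hi, hj, h.ne, fun k hk l hl hx => ?_⟩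
    rw [crosses_of_lt h] at hx
    rcases hc with hc | hc
    all_goals
      have := hc k hk
      have := hc l hl
      omega

/-- The part of the subpolygon `S` on the side of the arc `(a, b)` where the point `r` lies. -/
noncomputable def near (S : Finset (Fin n)) (a b r : Fin n) : Finset (Fin n) :=
  open Classical in S.filter fun v => ¬ Crosses a b r v

/-- The part of the subpolygon `S` on the side of the arc `(a, b)` opposite to the point `r`. -/
noncomputable def far (S : Finset (Fin n)) (a b r : Fin n) : Finset (Fin n) :=
  open Classical in S.filter fun v => v = a ∨ v = b ∨ Crosses a b r v

theorem mem_near {v : Fin n} : v ∈ near S a b r ↔ v ∈ S ∧ ¬ Crosses a b r v := by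
  simp [near]

theorem mem_far {v : Fin n} :
    v ∈ far S a b r ↔ v ∈ S ∧ (v = a ∨ v = b ∨ Crosses a b r v) := by
  simp [far]

theorem near_subset : near S a b r ⊆ S := fun _ h => (mem_near.1 h).1

theorem far_subset : far S a b r ⊆ S := fun _ h => (mem_far.1 h).1

theorem near_swap : near S a b r = near S b a r := by
  ext v
  simp only [mem_near, crosses_swap (i := a)]

theorem far_swap : far S a b r = far S b a r := by
  ext v
  simp only [mem_far, crosses_swap (i := a)]
  tauto

theorem near_or_far (v : Fin n) (hv : v ∈ S) : v ∈ near S a b r ∨ v ∈ far S a b r := by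
  rw [mem_near, mem_far]
  tauto

theorem left_mem_near (ha : a ∈ S) : a ∈ near S a b r :=
  mem_near.2 ⟨ha, fun h => h.ne.2.2.2.1 rfl⟩

theorem right_mem_near (hb : b ∈ S) : b ∈ near S a b r :=
  mem_near.2 ⟨hb, fun h => h.ne.2.2.2.2.2 rfl⟩

theorem self_mem_near (hr : r ∈ S) : r ∈ near S a b r :=
  mem_near.2 ⟨hr, fun h => h.ne.2.1 rfl⟩

theorem self_not_mem_far (ha : r ≠ a) (hb : r ≠ b) : r ∉ far S a b r := fun h => by
  rcases (mem_far.1 h).2 with h | h | h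
  · exact ha h
  · exact hb h
  · exact h.ne.2.1 rfl

theorem left_mem_far (ha : a ∈ S) : a ∈ far S a b r := mem_far.2 ⟨ha, .inl rfl⟩

theorem right_mem_far (hb : b ∈ S) : b ∈ far S a b r := mem_far.2 ⟨hb, .inr (.inl rfl)⟩

theorem mem_near_iff_of_lt {v : Fin n} (hab : a < b) (ha : r ≠ a) (hb : r ≠ b) :
    v ∈ near S a b r ↔ v ∈ S ∧ (a < r ∧ r < b ∧ a ≤ v ∧ v ≤ b ∨
      (r < a ∨ b < r) ∧ (v ≤ a ∨ b ≤ v)) := by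
  rw [mem_near, crosses_of_lt hab]
  refine and_congr_right fun _ => ?_
  omega

theorem mem_far_iff_of_lt {v : Fin n} (hab : a < b) (ha : r ≠ a) (hb : r ≠ b) :
    v ∈ far S a b r ↔ v ∈ S ∧ (a < r ∧ r < b ∧ (v ≤ a ∨ b ≤ v) ∨
      (r < a ∨ b < r) ∧ a ≤ v ∧ v ≤ b) := by
  rw [mem_far, crosses_of_lt hab]
  refine and_congr_right fun _ => ?_
  omega

/-- A side of one of the two halves into which the arc `(a, b)` divides `S` is a side of `S`,
unless it is the arc `(a, b)` itself. -/
theorem isSide_of_half_of_lt (hab : a < b) (ha : a ∈ S) (hb : b ∈ S) (hij : i < j)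
    (hR : (∀ v, v ∈ R ↔ v ∈ S ∧ a ≤ v ∧ v ≤ b) ∨ (∀ v, v ∈ R ↔ v ∈ S ∧ (v ≤ a ∨ b ≤ v)))
    (h : IsSide R i j) : IsSide S i j ∨ i = a ∧ j = b := by
  rw [isSide_iff_of_lt hij] at *
  obtain ⟨hi, hj, h⟩ := h
  rcases hR with hR | hR
  · have hi' := (hR i).1 hi
    have hj' := (hR j).1 hj
    rcases h with h | h
    · left
      refine ⟨hi'.1, hj'.1, .inl fun k hk => ?_⟩
      by_cases hk' : a ≤ k ∧ k ≤ b
      · exact h k ((hR k).2 ⟨hk, hk'⟩)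
      · omega
    · right
      have h1 := h a ((hR a).2 ⟨ha, le_rfl, hab.le⟩)
      have h2 := h b ((hR b).2 ⟨hb, hab.le, le_rfl⟩)
      omega
  · have hi' := (hR i).1 hi
    have hj' := (hR j).1 hj
    rcases h with h | h
    · by_cases hk : i ≤ a ∧ b ≤ j
      · right
        have h1 := h a ((hR a).2 ⟨ha, .inl le_rfl⟩)
        have h2 := h b ((hR b).2 ⟨hb, .inr le_rfl⟩)
        omega
      · left
        refine ⟨hi'.1, hj'.1, .inl fun k hk => ?_⟩
        by_cases hk' : k ≤ a ∨ b ≤ k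
        · exact h k ((hR k).2 ⟨hk, hk'⟩)
        · omega
    · left
      refine ⟨hi'.1, hj'.1, .inr fun k hk => ?_⟩
      have h1 := h a ((hR a).2 ⟨ha, .inl le_rfl⟩)
      have h2 := h b ((hR b).2 ⟨hb, .inr le_rfl⟩)
      by_cases hk' : k ≤ a ∨ b ≤ k
      · exact h k ((hR k).2 ⟨hk, hk'⟩)
      · omega

theorem isSide_of_isSide_half (hab : a ≠ b) (ha : a ∈ S) (hb : b ∈ S) (hra : r ≠ a) (hrb : r ≠ b)
    (hR : R = near S a b r ∨ R = far S a b r) (h : IsSide R i j) :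
    IsSide S i j ∨ i = a ∧ j = b ∨ i = b ∧ j = a := by
  wlog hlt : a < b generalizing a b
  · have := this hab.symm hb ha hrb hra (by rwa [near_swap, far_swap])
      (lt_of_le_of_ne (not_lt.1 hlt) hab.symm)
    tauto
  wlog hij : i < j generalizing i j
  · have := this h.symm (lt_of_le_of_ne (not_lt.1 hij) h.2.2.1.symm)
    have h' : IsSide S j i → IsSide S i j := IsSide.symm
    tauto
  have := isSide_of_half_of_lt (R := R) hlt ha hb hij ?_ h
  · tauto
  have key : a < r ∧ r < b ∨ r < a ∨ b < r := by omega
  rcases hR with rfl | rfl <;> rcases key with key | key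
  · refine .inl fun v => ?_
    rw [mem_near_iff_of_lt hlt hra hrb]
    exact and_congr_right fun _ => by omega
  · refine .inr fun v => ?_
    rw [mem_near_iff_of_lt hlt hra hrb]
    exact and_congr_right fun _ => by omega
  · refine .inr fun v => ?_
    rw [mem_far_iff_of_lt hlt hra hrb]
    exact and_congr_right fun _ => by omega
  · refine .inl fun v => ?_
    rw [mem_far_iff_of_lt hlt hra hrb]
    exact and_congr_right fun _ => by omega

/-- A vertex `y` outside the subpolygon `S` is cut off by a side of `S`. -/
theorem exists_isSide_separating {y : Fin n} (hS : 3 ≤ S.card) (hy : y ∉ S) :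
    ∃ s t, IsSide S s t ∧ ∀ u ∈ S, u = s ∨ u = t ∨ Crosses s t y u := by
  have hne : S.Nonempty := card_pos.1 (by omega)
  -- With elements of `S` both below and above `y`, its two neighbours in `S` form the side;
  -- otherwise `y` lies in the wrap-around gap, and the side joins the minimum to the maximum.
  by_cases h : (S.filter (· < y)).Nonempty ∧ (S.filter (y < ·)).Nonempty
  · obtain ⟨h1, h2⟩ := h
    have m1 := mem_filter.1 (max'_mem _ h1)
    have m2 := mem_filter.1 (min'_mem _ h2)
    set s := (S.filter (· < y)).max' h1
    set t := (S.filter (y < ·)).min' h2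
    have key : ∀ u ∈ S, u ≤ s ∨ t ≤ u := fun u hu => by
      rcases lt_trichotomy u y with h | h | h
      · exact .inl (le_max' _ _ (mem_filter.2 ⟨hu, h⟩))
      · exact absurd (h ▸ hu) hy
      · exact .inr (min'_le _ _ (mem_filter.2 ⟨hu, h⟩))
    have hst : s < t := m1.2.trans m2.2
    refine ⟨s, t, (isSide_iff_of_lt hst).2 ⟨m1.1, m2.1, .inl key⟩, fun u hu => ?_⟩
    rw [crosses_of_lt hst]
    have := key u hu
    omega
  · have h' : (∀ u ∈ S, y < u) ∨ ∀ u ∈ S, u < y := by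
      rw [not_and_or, not_nonempty_iff_eq_empty, not_nonempty_iff_eq_empty,
        filter_eq_empty_iff, filter_eq_empty_iff] at h
      refine h.imp (fun h u hu => ?_) (fun h u hu => ?_)
      · exact lt_of_le_of_ne (not_lt.1 (h hu)) fun e => hy (e ▸ hu)
      · exact lt_of_le_of_ne (not_lt.1 (h hu)) fun e => hy (e ▸ hu)
    have m1 := min'_mem S hne
    have m2 := max'_mem S hne
    have key : ∀ u ∈ S, S.min' hne ≤ u ∧ u ≤ S.max' hne := fun u hu =>
      ⟨min'_le _ _ hu, le_max' _ _ hu⟩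
    have hst : S.min' hne < S.max' hne := min'_lt_max'_of_card _ (by omega)
    set s := S.min' hne
    set t := S.max' hne
    refine ⟨s, t, (isSide_iff_of_lt hst).2 ⟨m1, m2, .inr key⟩, fun u hu => ?_⟩
    rw [crosses_of_lt hst]
    have := key u hu
    rcases h' with h' | h'
    all_goals
      have := h' _ m1
      have := h' _ m2
      omega

theorem exists_mem_ne_ne (hS : 3 ≤ S.card) (s t : Fin n) : ∃ u ∈ S, u ≠ s ∧ u ≠ t := by
  by_contra! h
  have : S ⊆ {s, t} := fun u hu => by
    simp only [mem_insert, mem_singleton]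
    by_contra! hn
    exact hn.2 (h u hu hn.1)
  have := (card_le_card this).trans card_le_two
  omega

/-- A subpolygon all of whose sides are sides of `S` is `S`. -/
theorem eq_of_subset_of_isSide (hRS : R ⊆ S) (hR : 3 ≤ R.card)
    (h : ∀ i j, IsSide R i j → IsSide S i j) : R = S := by
  refine hRS.antisymm fun y hy => ?_
  by_contra hyR
  obtain ⟨s, t, hst, hu⟩ := exists_isSide_separating hR hyR
  obtain ⟨u, huR, hus, hut⟩ := exists_mem_ne_ne hR s t
  exact (h s t hst).2.2.2 y hy u (hRS huR) (((hu u huR).resolve_left hus).resolve_left hut)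

end Sides

/-! ### Subpolygons and pieces of a dissection -/

section Pieces

open Finset

variable {n : ℕ} {S R X : Finset (Fin n)} {i j a b c d r v x y : Fin n} {D E : SimpleGraph (Fin n)}

/-- The subpolygon with vertex set `S` is bounded by arcs of `D` and sides of the polygon. -/
def IsSubpolygon (D : SimpleGraph (Fin n)) (S : Finset (Fin n)) : Prop :=
  3 ≤ S.card ∧ ∀ i j, IsSide S i j → IsSide univ i j ∨ D.Adj i j

theorem isSubpolygon_univ (hn : 3 ≤ n) : IsSubpolygon D univ :=
  ⟨by simpa using hn, fun _ _ h => .inl h⟩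

theorem IsPiece.isSubpolygon (h : IsPiece D univ R) : IsSubpolygon D R :=
  ⟨h.three_le_card, h.side⟩

theorem IsSubpolygon.mono (h : IsSubpolygon E S) (hED : E ≤ D) : IsSubpolygon D S :=
  ⟨h.1, fun i j hij => (h.2 i j hij).imp_right fun h => hED h⟩

theorem IsSubpolygon.isPiece (hS : IsSubpolygon D S) (h : ∀ i j, IsDiagonal S i j → ¬ D.Adj i j) :
    IsPiece D univ S :=
  ⟨subset_univ _, hS.1, hS.2, h⟩

/-- Makes pieces independent of the ambient subpolygon, so that inductions can be phrased with
pieces of the whole polygon. -/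
theorem IsSubpolygon.isPiece_iff (hS : IsSubpolygon D S) :
    IsPiece D S R ↔ IsPiece D univ R ∧ R ⊆ S := by
  constructor
  · intro h
    refine ⟨⟨subset_univ _, h.three_le_card, fun i j hij => ?_, h.not_adj⟩, h.subset⟩
    rcases h.side i j hij with h | h
    · exact hS.2 i j h
    · exact .inr h
  · rintro ⟨h, hRS⟩
    exact ⟨hRS, h.three_le_card, fun i j hij =>
      (h.side i j hij).imp_left fun h => h.of_subset (subset_univ _) (hRS hij.1) (hRS hij.2.1),
      h.not_adj⟩

theorem not_isSide_univ (h : Crosses i j a b) : ¬ IsSide univ i j :=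
  fun hs => hs.2.2.2 a (mem_univ _) b (mem_univ _) h

/-- The side of `S` that cuts off `y` is crossed by a chord from `y` to a third vertex of `S`, so it
is not a side of the polygon and must belong to `D`. -/
theorem IsSubpolygon.exists_adj_separating (hS : IsSubpolygon D S) (hy : y ∉ S) :
    ∃ s t u, s ∈ S ∧ t ∈ S ∧ D.Adj s t ∧ u ∈ S ∧ Crosses s t y u ∧
      ∀ u ∈ S, u = s ∨ u = t ∨ Crosses s t y u := by
  obtain ⟨s, t, hst, hu⟩ := exists_isSide_separating hS.1 hy
  obtain ⟨u, huR, hus, hut⟩ := exists_mem_ne_ne hS.1 s t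
  have hc := ((hu u huR).resolve_left hus).resolve_left hut
  exact ⟨s, t, u, hst.1, hst.2.1, (hS.2 s t hst).resolve_left (not_isSide_univ hc), huR, hc, hu⟩

/-- If `x` were outside `S`, an arc of `D` would cut it off from `S`; the arc `(x, y)`, which meets
a chord of `S`, would have to cross that arc. -/
theorem IsSubpolygon.left_mem_of_crosses (hD : IsDissection D) (hS : IsSubpolygon D S)
    (hxy : D.Adj x y) (h : Crosses x y a b) (ha : a ∈ S) (hb : b ∈ S) : x ∈ S := by
  by_contra hx
  obtain ⟨s, t, u, -, -, hst, -, hc, hsep⟩ := hS.exists_adj_separating hx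
  exact hD.2 s t y x hst hxy.symm (h.swap.of_separates hc (hsep a ha) (hsep b hb))

theorem IsSubpolygon.isDiagonal_of_crosses (hD : IsDissection D) (hS : IsSubpolygon D S)
    (hxy : D.Adj x y) (h : Crosses x y a b) (ha : a ∈ S) (hb : b ∈ S) : IsDiagonal S x y :=
  ⟨hS.left_mem_of_crosses hD hxy h ha hb, hS.left_mem_of_crosses hD hxy.symm h.swap ha hb,
    a, ha, b, hb, h⟩

theorem IsPiece.not_crosses (hD : IsDissection D) (hR : IsPiece D univ R)
    (hxy : D.Adj x y) (ha : a ∈ R) (hb : b ∈ R) : ¬ Crosses x y a b := fun h =>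
  hR.not_adj x y (hR.isSubpolygon.isDiagonal_of_crosses hD hxy h ha hb) hxy

/-- A piece that has a diagonal which crosses an arc in a subpolygon lies in the subpolygon. -/
theorem IsPiece.subset_of_crosses (hD : IsDissection D) (hR : IsPiece D univ R)
    (hS : IsSubpolygon D S) (h : Crosses a b c d) (ha : a ∈ S) (hb : b ∈ S) (hc : c ∈ R)
    (hd : d ∈ R) : R ⊆ S := by
  intro y hy
  by_contra hyS
  obtain ⟨s, t, u, -, -, hst, -, hcr, hsep⟩ := hS.exists_adj_separating hyS
  exact not_crosses_of_separated hcr (hsep a ha) (hsep b hb) (hR.not_crosses hD hst hy hc)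
    (hR.not_crosses hD hst hy hd) h

theorem IsPiece.eq_of_crosses (hD : IsDissection D) (hR : IsPiece D univ R)
    (hS : IsPiece D univ S) (h : Crosses a b c d) (ha : a ∈ S) (hb : b ∈ S) (hc : c ∈ R)
    (hd : d ∈ R) : R = S :=
  (hR.subset_of_crosses hD hS.isSubpolygon h ha hb hc hd).antisymm
    (hS.subset_of_crosses hD hR.isSubpolygon h.symm hc hd ha hb)

theorem IsSubpolygon.half (hS : IsSubpolygon D S) (hab : D.Adj a b) (ha : a ∈ S) (hb : b ∈ S)
    (hra : r ≠ a) (hrb : r ≠ b) (hR : R = near S a b r ∨ R = far S a b r) (hc : 3 ≤ R.card) :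
    IsSubpolygon D R := by
  refine ⟨hc, fun i j hij => ?_⟩
  rcases isSide_of_isSide_half hab.ne ha hb hra hrb hR hij with h | ⟨rfl, rfl⟩ | ⟨rfl, rfl⟩
  · exact hS.2 i j h
  · exact .inr hab
  · exact .inr hab.symm

theorem IsSubpolygon.near (hS : IsSubpolygon D S) (hab : D.Adj a b) (ha : a ∈ S) (hb : b ∈ S)
    (hr : r ∈ S) (hra : r ≠ a) (hrb : r ≠ b) : IsSubpolygon D (near S a b r) := by
  refine hS.half hab ha hb hra hrb (.inl rfl) (two_lt_card.2 ?_)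
  exact ⟨a, left_mem_near ha, b, right_mem_near hb, r, self_mem_near hr, hab.ne, hra.symm, hrb.symm⟩

theorem exists_crosses_of_isDiagonal (h : IsDiagonal S a b) (hra : r ≠ a) (hrb : r ≠ b) :
    ∃ x ∈ S, Crosses a b r x := by
  obtain ⟨_, _, k, hk, l, hl, hc⟩ := h
  rcases hc.trans_left hra hrb with h | h
  · exact ⟨k, hk, h⟩
  · exact ⟨l, hl, h⟩

theorem IsSubpolygon.far (hS : IsSubpolygon D S) (hab : D.Adj a b) (h : IsDiagonal S a b)
    (hra : r ≠ a) (hrb : r ≠ b) : IsSubpolygon D (far S a b r) := by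
  refine hS.half hab h.1 h.2.1 hra hrb (.inr rfl) (two_lt_card.2 ?_)
  obtain ⟨x, hx, hc⟩ := exists_crosses_of_isDiagonal h hra hrb
  exact ⟨a, left_mem_far h.1, b, right_mem_far h.2.1, x, mem_far.2 ⟨hx, .inr (.inr hc)⟩, hab.ne,
    hc.ne.2.2.2.1, hc.ne.2.2.2.2.2⟩

theorem card_near_lt (h : IsDiagonal S a b) (hra : r ≠ a) (hrb : r ≠ b) :
    (PolygonFrieze.near S a b r).card < S.card := by
  obtain ⟨x, hx, hc⟩ := exists_crosses_of_isDiagonal h hra hrb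
  exact card_lt_card ⟨near_subset, fun hs => (mem_near.1 (hs hx)).2 hc⟩

theorem card_far_lt (hr : r ∈ S) (hra : r ≠ a) (hrb : r ≠ b) :
    (PolygonFrieze.far S a b r).card < S.card :=
  card_lt_card ⟨far_subset, fun hs => self_not_mem_far hra hrb (hs hr)⟩

theorem IsDiagonal.exists_third (h : IsDiagonal S a b) : ∃ r ∈ S, r ≠ a ∧ r ≠ b := by
  obtain ⟨_, _, k, hk, l, hl, hc⟩ := h
  exact ⟨k, hk, hc.ne.2.2.1.symm, hc.ne.2.2.2.2.1.symm⟩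

theorem subset_near_or_far (hX : X ⊆ S) (h : ∀ x ∈ X, ∀ y ∈ X, ¬ Crosses a b x y) :
    X ⊆ PolygonFrieze.near S a b r ∨ X ⊆ PolygonFrieze.far S a b r := by
  by_contra! hn
  obtain ⟨x, hx, hxn⟩ := not_subset.1 hn.1
  obtain ⟨y, hy, hyf⟩ := not_subset.1 hn.2
  rw [mem_near, not_and_not_right] at hxn
  rw [mem_far] at hyf
  push Not at hyf
  obtain ⟨hya, hyb, hyc⟩ := hyf (hX hy)
  exact ((hxn (hX hx)).trans_left hya hyb).elim (fun h => hyc h.swap_right) (h y hy x hx ·)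

/-- A set of vertices of `S` that is not separated by `D` lies in a piece. -/
theorem IsSubpolygon.exists_isPiece (hS : IsSubpolygon D S) (hXS : X ⊆ S)
    (hX : ∀ i j, D.Adj i j → ∀ x ∈ X, ∀ y ∈ X, ¬ Crosses i j x y) :
    ∃ R, IsPiece D univ R ∧ X ⊆ R ∧ R ⊆ S := by
  induction hm : S.card using Nat.strong_induction_on generalizing S with
  | _ m ih =>
    subst hm
    by_cases h : ∀ i j, IsDiagonal S i j → ¬ D.Adj i j
    · exact ⟨S, hS.isPiece h, hXS, Subset.rfl⟩
    push Not at h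
    obtain ⟨a, b, hd, hab⟩ := h
    obtain ⟨r, hr, hra, hrb⟩ := hd.exists_third
    rcases subset_near_or_far (r := r) hXS (hX a b hab) with h | h
    · obtain ⟨R, h1, h2, h3⟩ := ih _ (card_near_lt hd hra hrb)
        (hS.near hab hd.1 hd.2.1 hr hra hrb) h rfl
      exact ⟨R, h1, h2, h3.trans near_subset⟩
    · obtain ⟨R, h1, h2, h3⟩ := ih _ (card_far_lt hr hra hrb) (hS.far hab hd hra hrb) h rfl
      exact ⟨R, h1, h2, h3.trans far_subset⟩

theorem IsSubpolygon.exists_isPiece_mem (hS : IsSubpolygon D S) (hv : v ∈ S) :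
    ∃ R, IsPiece D univ R ∧ v ∈ R ∧ R ⊆ S := by
  obtain ⟨R, h1, h2, h3⟩ := hS.exists_isPiece (X := {v}) (by simpa using hv) (by
    simp only [mem_singleton, forall_eq]
    exact fun i j _ h => h.ne.2.1 rfl)
  exact ⟨R, h1, by simpa using h2, h3⟩

theorem IsTowerDecomposition.isDissection (hD : IsDissection D) (h : IsTowerDecomposition D E) :
    IsDissection E :=
  ⟨fun i j hij => hD.1 i j (h.1 hij), fun i j k l h1 h2 => hD.2 i j k l (h.1 h1) (h.1 h2)⟩

/-- The pieces of a gluing of towers are triangles and quadrilaterals. -/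
theorem IsTowerDecomposition.card_piece (hn : 3 ≤ n) (hD : IsDissection D)
    (h : IsTowerDecomposition D E) (hR : IsPiece D univ R) : R.card = 3 ∨ R.card = 4 := by
  obtain ⟨Q, hQ, hRQ, -⟩ := (isSubpolygon_univ (D := E) hn).exists_isPiece (subset_univ R)
    fun i j hij x hx y hy => hR.not_crosses hD (h.1 hij) hx hy
  obtain ⟨m, hm⟩ := h.2 Q hQ
  exact hm.card_piece R ((hQ.isSubpolygon.mono h.1).isPiece_iff.2 ⟨hR, hRQ⟩)

end Pieces

/-! ### Realizing the weights by determinants of vectors -/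

section Models

open Finset

variable {n : ℕ} {S R : Finset (Fin n)} {i j a b c d r v x y : Fin n} {D E : SimpleGraph (Fin n)}

theorem exists_eq_of_card_eq_three (h : S.card = 3) :
    ∃ a b c, a < b ∧ b < c ∧ ∀ v, v ∈ S ↔ v = a ∨ v = b ∨ v = c := by
  have lt : ∀ i j : Fin 3, i < j → S.orderEmbOfFin h i < S.orderEmbOfFin h j := fun i j hij =>
    (S.orderEmbOfFin h).strictMono hij
  refine ⟨_, _, _, lt 0 1 (by decide), lt 1 2 (by decide), fun v => ?_⟩
  rw [← mem_coe, ← range_orderEmbOfFin S h]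
  simp only [Set.mem_range, Fin.exists_fin_succ, IsEmpty.exists_iff, or_false, eq_comm (b := v)]
  rfl

theorem exists_eq_of_card_eq_four (h : S.card = 4) :
    ∃ a b c d, a < b ∧ b < c ∧ c < d ∧ ∀ v, v ∈ S ↔ v = a ∨ v = b ∨ v = c ∨ v = d := by
  have lt : ∀ i j : Fin 4, i < j → S.orderEmbOfFin h i < S.orderEmbOfFin h j := fun i j hij =>
    (S.orderEmbOfFin h).strictMono hij
  refine ⟨_, _, _, _, lt 0 1 (by decide), lt 1 2 (by decide), lt 2 3 (by decide), fun v => ?_⟩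
  rw [← mem_coe, ← range_orderEmbOfFin S h]
  simp only [Set.mem_range, Fin.exists_fin_succ, IsEmpty.exists_iff, or_false, eq_comm (b := v)]
  rfl

/-- The determinant of two vectors in the plane. -/
def det₂ {R : Type*} [CommRing R] (p q : R × R) : R := p.1 * q.2 - p.2 * q.1

theorem sqrtTwoToReal_apply (z : ℤ√2) : sqrtTwoToReal z = z.re + z.im * √2 := by
  simp [sqrtTwoToReal, Zsqrtd.toReal]

/-- The symbol `√2` in `ℤ[√2]`. -/
def rootTwo : ℤ√2 := ⟨0, 1⟩

theorem rootTwo_mul_self : rootTwo * rootTwo = 2 := by decide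

theorem sqrtTwoToReal_rootTwo : sqrtTwoToReal rootTwo = √2 := by
  simp [sqrtTwoToReal_apply, rootTwo]

/-- A family of vectors whose determinants realize the frieze from `D` on the subpolygon `S`. -/
structure IsModel (D : SimpleGraph (Fin n)) (S : Finset (Fin n)) (w : Fin n → ℤ√2 × ℤ√2) :
    Prop where
  pos : ∀ i ∈ S, ∀ j ∈ S, i < j → 0 < sqrtTwoToReal (det₂ (w i) (w j))
  one : ∀ i ∈ S, ∀ j ∈ S, i < j → IsSide univ i j ∨ D.Adj i j → det₂ (w i) (w j) = 1
  diagonal : ∀ R, IsPiece D univ R → ∀ i ∈ S, ∀ j ∈ S, i < j → IsDiagonal R i j →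
    det₂ (w i) (w j) = rootTwo

theorem IsPiece.exists_isModel (hD : IsDissection D) (hS : IsPiece D univ S)
    (hc : S.card = 3 ∨ S.card = 4) : ∃ w, IsModel D S w := by
  have hside : ∀ i ∈ S, ∀ j ∈ S, IsSide univ i j ∨ D.Adj i j → ¬ IsDiagonal S i j := by
    rintro i hi j hj (h | h) hd
    · exact (h.of_subset (subset_univ S) hi hj).not_isDiagonal hd
    · exact hS.not_adj i j hd h
  -- A diagonal of a piece `R` crosses a chord of `R`; if its ends are in `S` as well, this forces
  -- `R = S`.
  have hdiag : ∀ R, IsPiece D univ R → ∀ i ∈ S, ∀ j ∈ S, IsDiagonal R i j → IsDiagonal S i j := by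
    rintro R hR i hi j hj ⟨hi', hj', k, hk, l, hl, hx⟩
    have := hR.eq_of_crosses hD hS hx hi hj hk hl
    subst this
    exact ⟨hi, hj, k, hk, l, hl, hx⟩
  suffices h : ∃ w : Fin n → ℤ√2 × ℤ√2, ∀ i ∈ S, ∀ j ∈ S, i < j →
      0 < sqrtTwoToReal (det₂ (w i) (w j)) ∧ (¬ IsDiagonal S i j → det₂ (w i) (w j) = 1) ∧
      (IsDiagonal S i j → det₂ (w i) (w j) = rootTwo) by
    obtain ⟨w, hw⟩ := h
    exact ⟨w, fun i hi j hj hij => (hw i hi j hj hij).1,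
      fun i hi j hj hij h => (hw i hi j hj hij).2.1 (hside i hi j hj h),
      fun R hR i hi j hj hij h => (hw i hi j hj hij).2.2 (hdiag R hR i hi j hj h)⟩
  have key : ∀ {i j}, i ∈ S → j ∈ S → i < j → (IsDiagonal S i j ↔
      ¬ ((∀ k ∈ S, k ≤ i ∨ j ≤ k) ∨ ∀ k ∈ S, i ≤ k ∧ k ≤ j)) := fun {i j} hi hj hij => by
    have h1 := isSide_iff_of_lt (S := S) hij
    have h2 := isSide_of_not_isDiagonal hi hj hij.ne
    have h3 : IsSide S i j → ¬ IsDiagonal S i j := IsSide.not_isDiagonal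
    tauto
  have h2 : (0 : ℝ) < √2 := by positivity
  rcases hc with hc | hc
  · obtain ⟨a, b, c, hab, hbc, hm⟩ := exists_eq_of_card_eq_three hc
    -- Each further vector is obtained from `v (i + 1) = x • v i - v (i - 1)` with `x = 2 cos (π /
    -- 3) = 1`.
    refine ⟨fun v => if v = a then (1, 0) else if v = b then (0, 1) else (-1, 1), ?_⟩
    intro i hi j hj hij
    rw [key hi hj hij]
    rw [hm] at hi hj
    rcases hi with rfl | rfl | rfl <;> rcases hj with rfl | rfl | rfl <;> try omega
    all_goals
      simp [hm, det₂, hij.ne', hab.ne', hbc.ne', (hab.trans hbc).ne', hab.le, hbc.le,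
        (hab.trans hbc).le]
  · obtain ⟨a, b, c, d, hab, hbc, hcd, hm⟩ := exists_eq_of_card_eq_four hc
    -- The same recursion with `x = 2 cos (π / 4) = √2`.
    refine ⟨fun v => if v = a then (1, 0) else if v = b then (0, 1) else
      if v = c then (-1, rootTwo) else (-rootTwo, 1), ?_⟩
    intro i hi j hj hij
    rw [key hi hj hij]
    rw [hm] at hi hj
    have hac := hab.trans hbc
    have hbd := hbc.trans hcd
    have had := hac.trans hcd
    have e1 : rootTwo * rootTwo = 2 := rootTwo_mul_self
    have e2 := sqrtTwoToReal_rootTwo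
    have e3 : (-1 : ℤ√2) + 2 = 1 := by norm_num
    rcases hi with rfl | rfl | rfl | rfl <;> rcases hj with rfl | rfl | rfl | rfl <;> try omega
    all_goals
      simp [hm, det₂, hij.ne', hab.ne', hbc.ne', hcd.ne', hac.ne', hbd.ne', had.ne', hab.le, hbc.le,
        hcd.le, hac.le, hbd.le, had.le, hab, hbc, hcd, e1, e2, e3]

/-- The coordinates of `s` in the unimodular basis `p', q'` are `det₂ s q'` and `det₂ p' s`. Using
them with `p, q` instead is a linear map of determinant 1. -/
theorem det₂_basis {R : Type*} [CommRing R] {p q p' q' s t : R × R} (h : det₂ p q = 1)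
    (h' : det₂ p' q' = 1) :
    det₂ (det₂ s q' • p + det₂ p' s • q) (det₂ t q' • p + det₂ p' t • q) = det₂ s t := by
  simp only [det₂, Prod.fst_add, Prod.snd_add, Prod.smul_fst, Prod.smul_snd, smul_eq_mul] at *
  linear_combination (s.1 * t.2 - s.2 * t.1) * (p'.1 * q'.2 - p'.2 * q'.1) * h +
    (s.1 * t.2 - s.2 * t.1) * h'

/-- Models of two subpolygons that share an arc of weight one can be glued. -/
theorem IsModel.glue (hD : IsDissection D) (hab : D.Adj a b) (hlt : a < b) {S₁ S₂ : Finset (Fin n)}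
    (h₁ : ∀ v, v ∈ S₁ ↔ v ∈ S ∧ a ≤ v ∧ v ≤ b) (h₂ : ∀ v, v ∈ S₂ ↔ v ∈ S ∧ (v ≤ a ∨ b ≤ v))
    (ha : a ∈ S) (hb : b ∈ S) {w₁ w₂ : Fin n → ℤ√2 × ℤ√2} (hw₁ : IsModel D S₁ w₁)
    (hw₂ : IsModel D S₂ w₂) : ∃ w, IsModel D S w := by
  have ha1 : a ∈ S₁ := (h₁ a).2 ⟨ha, le_rfl, hlt.le⟩
  have hb1 : b ∈ S₁ := (h₁ b).2 ⟨hb, hlt.le, le_rfl⟩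
  have ha2 : a ∈ S₂ := (h₂ a).2 ⟨ha, .inl le_rfl⟩
  have hb2 : b ∈ S₂ := (h₂ b).2 ⟨hb, .inr le_rfl⟩
  have e1 := hw₁.one a ha1 b hb1 hlt (.inr hab)
  have e2 := hw₂.one a ha2 b hb2 hlt (.inr hab)
  -- Keep `w₁` between `a` and `b`, and move `w₂` by the unimodular map that takes `w₂ a, w₂ b` to
  -- `w₁ a, w₁ b`.
  obtain ⟨w, hwd⟩ : ∃ w : Fin n → ℤ√2 × ℤ√2, w = fun v => if a ≤ v ∧ v ≤ b then w₁ v else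
      det₂ (w₂ v) (w₂ b) • w₁ a + det₂ (w₂ a) (w₂ v) • w₁ b := ⟨_, rfl⟩
  have hw1 : ∀ v ∈ S₁, w v = w₁ v := fun v hv => by
    rw [hwd]; exact if_pos ((h₁ v).1 hv).2
  have hw2 : ∀ v ∈ S₂, w v = det₂ (w₂ v) (w₂ b) • w₁ a + det₂ (w₂ a) (w₂ v) • w₁ b := fun v hv => by
    have hv' := ((h₂ v).1 hv).2
    by_cases hva : v = a
    · subst hva
      rw [hw1 v ha1, e2]
      simp [det₂, mul_comm]
    by_cases hvb : v = b
    · subst hvb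
      rw [hw1 v hb1, e2]
      simp [det₂, mul_comm]
    · rw [hwd]; exact if_neg (by omega)
  have hd1 : ∀ i ∈ S₁, ∀ j ∈ S₁, det₂ (w i) (w j) = det₂ (w₁ i) (w₁ j) := fun i hi j hj => by
    rw [hw1 i hi, hw1 j hj]
  have hd2 : ∀ i ∈ S₂, ∀ j ∈ S₂, det₂ (w i) (w j) = det₂ (w₂ i) (w₂ j) := fun i hi j hj => by
    rw [hw2 i hi, hw2 j hj, det₂_basis e1 e2]
  have hex : ∀ i ∈ S, ∀ j ∈ S, ¬ Crosses a b i j → (i ∈ S₁ ∧ j ∈ S₁) ∨ (i ∈ S₂ ∧ j ∈ S₂) :=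
    fun i hi j hj h => by
      rw [crosses_of_lt hlt] at h
      simp only [h₁, h₂, hi, hj, true_and]
      omega
  refine ⟨w, ?_, ?_, ?_⟩
  · intro i hi j hj hij
    -- Across the cut, the determinant expands as in Ptolemy's relation into a sum of products of
    -- positive determinants from the two halves.
    by_cases h : Crosses a b i j
    · rw [crosses_of_lt hlt] at h
      rcases h with ⟨hi1, hi2, h⟩ | ⟨hj1, hj2, h⟩
      · have hj1 : b < j := by omega
        have hi' : i ∈ S₁ := (h₁ i).2 ⟨hi, hi1.le, hi2.le⟩
        have hj' : j ∈ S₂ := (h₂ j).2 ⟨hj, .inr hj1.le⟩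
        have p1 := hw₁.pos a ha1 i hi' hi1
        have p2 := hw₁.pos i hi' b hb1 hi2
        have p3 := hw₂.pos b hb2 j hj' hj1
        have p4 := hw₂.pos a ha2 j hj' (hlt.trans hj1)
        have : det₂ (w i) (w j) = det₂ (w₁ a) (w₁ i) * det₂ (w₂ b) (w₂ j) +
            det₂ (w₁ i) (w₁ b) * det₂ (w₂ a) (w₂ j) := by
          rw [hw1 i hi', hw2 j hj']
          simp only [det₂, Prod.fst_add, Prod.snd_add, Prod.smul_fst, Prod.smul_snd, smul_eq_mul]
          ring
        rw [this, map_add, map_mul, map_mul]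
        positivity
      · have hi1 : i < a := by omega
        have hj' : j ∈ S₁ := (h₁ j).2 ⟨hj, hj1.le, hj2.le⟩
        have hi' : i ∈ S₂ := (h₂ i).2 ⟨hi, .inl hi1.le⟩
        have p1 := hw₁.pos a ha1 j hj' hj1
        have p2 := hw₁.pos j hj' b hb1 hj2
        have p3 := hw₂.pos i hi' b hb2 (hi1.trans hlt)
        have p4 := hw₂.pos i hi' a ha2 hi1
        have : det₂ (w i) (w j) = det₂ (w₂ i) (w₂ b) * det₂ (w₁ a) (w₁ j) +
            det₂ (w₂ i) (w₂ a) * det₂ (w₁ j) (w₁ b) := by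
          rw [hw1 j hj', hw2 i hi']
          simp only [det₂, Prod.fst_add, Prod.snd_add, Prod.smul_fst, Prod.smul_snd, smul_eq_mul]
          ring
        rw [this, map_add, map_mul, map_mul]
        positivity
    · rcases hex i hi j hj h with ⟨hi', hj'⟩ | ⟨hi', hj'⟩
      · rw [hd1 i hi' j hj']
        exact hw₁.pos i hi' j hj' hij
      · rw [hd2 i hi' j hj']
        exact hw₂.pos i hi' j hj' hij
  · intro i hi j hj hij h
    have hx : ¬ Crosses a b i j := fun hx => by
      rcases h with h | h
      · exact not_isSide_univ hx.symm h
      · exact hD.2 a b i j hab h hx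
    rcases hex i hi j hj hx with ⟨hi', hj'⟩ | ⟨hi', hj'⟩
    · rw [hd1 i hi' j hj']
      exact hw₁.one i hi' j hj' hij h
    · rw [hd2 i hi' j hj']
      exact hw₂.one i hi' j hj' hij h
  · intro R hR i hi j hj hij h
    rcases hex i hi j hj (hR.not_crosses hD hab h.1 h.2.1) with ⟨hi', hj'⟩ | ⟨hi', hj'⟩
    · rw [hd1 i hi' j hj']
      exact hw₁.diagonal R hR i hi' j hj' hij h
    · rw [hd2 i hi' j hj']
      exact hw₂.diagonal R hR i hi' j hj' hij h

theorem IsSubpolygon.exists_isModel (hD : IsDissection D)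
    (hc : ∀ R, IsPiece D univ R → R.card = 3 ∨ R.card = 4) (hS : IsSubpolygon D S) :
    ∃ w, IsModel D S w := by
  induction hm : S.card using Nat.strong_induction_on generalizing S with
  | _ m ih =>
    subst hm
    by_cases h : ∀ i j, IsDiagonal S i j → ¬ D.Adj i j
    · exact (hS.isPiece h).exists_isModel hD (hc S (hS.isPiece h))
    push Not at h
    obtain ⟨a, b, hd, hab⟩ := h
    wlog hlt : a < b generalizing a b
    · exact this b a hd.symm hab.symm (lt_of_le_of_ne (not_lt.1 hlt) hab.ne.symm)
    -- Taking `r` strictly between `a` and `b` makes the near half the interval from `a` to `b`, the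
    -- form required for gluing.
    obtain ⟨r, hr, har, hrb⟩ : ∃ r ∈ S, a < r ∧ r < b := by
      obtain ⟨_, _, k, hk, l, hl, hx⟩ := hd
      rw [crosses_of_lt hlt] at hx
      rcases hx with hx | hx
      · exact ⟨k, hk, hx.1, hx.2.1⟩
      · exact ⟨l, hl, hx.1, hx.2.1⟩
    obtain ⟨w₁, hw₁⟩ := ih _ (card_near_lt hd har.ne' hrb.ne)
      (hS.near hab hd.1 hd.2.1 hr har.ne' hrb.ne) rfl
    obtain ⟨w₂, hw₂⟩ := ih _ (card_far_lt hr har.ne' hrb.ne) (hS.far hab hd har.ne' hrb.ne) rfl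
    refine IsModel.glue hD hab hlt ?_ ?_ hd.1 hd.2.1 hw₁ hw₂
    · exact fun v => by
        rw [mem_near_iff_of_lt hlt har.ne' hrb.ne]; refine and_congr_right fun _ => ?_; omega
    · exact fun v => by
        rw [mem_far_iff_of_lt hlt har.ne' hrb.ne]; refine and_congr_right fun _ => ?_; omega

end Models

/-! ### Existence and uniqueness of the frieze -/

section Frieze

open Finset

variable {n : ℕ} {S R : Finset (Fin n)} {i j a b c d r v x y : Fin n} {D E : SimpleGraph (Fin n)}

/-- The symmetric weights given by the determinants of a family of vectors. -/
def weight {R : Type*} [CommRing R] (w : Fin n → R × R) (i j : Fin n) : R :=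
  if i < j then det₂ (w i) (w j) else det₂ (w j) (w i)

theorem weight_of_lt {R : Type*} [CommRing R] (w : Fin n → R × R) (h : i < j) :
    weight w i j = det₂ (w i) (w j) := if_pos h

theorem weight_self {R : Type*} [CommRing R] (w : Fin n → R × R) (i : Fin n) :
    weight w i i = 0 := by
  simp [weight, det₂, mul_comm]

theorem weight_symm {R : Type*} [CommRing R] (w : Fin n → R × R) (i j : Fin n) :
    weight w i j = weight w j i := by
  rcases lt_trichotomy i j with h | rfl | h
  · simp [weight, h, h.not_gt]
  · rfl
  · simp [weight, h, h.not_gt]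

/-- This is the Plücker relation for four vectors in the plane, once the indices are sorted. -/
theorem weight_ptolemy {R : Type*} [CommRing R] (w : Fin n → R × R) (i j k l : Fin n)
    (h : Crosses i j k l) :
    weight w i j * weight w k l = weight w i l * weight w j k + weight w i k * weight w j l := by
  wlog hij : i < j generalizing i j
  · have := this j i h.swap (lt_of_le_of_ne (not_lt.1 hij) h.ne.1.symm)
    rw [weight_symm w i j]
    linear_combination this
  wlog hkl : k < l generalizing k l
  · have := this l k h.swap_right (lt_of_le_of_ne (not_lt.1 hkl) h.ne.2.1.symm)
    rw [weight_symm w k l]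
    linear_combination this
  rw [crosses_of_lt hij] at h
  have h' : (i < k ∧ k < j ∧ j < l) ∨ (k < i ∧ i < l ∧ l < j) := by omega
  rcases h' with ⟨h1, h2, h3⟩ | ⟨h1, h2, h3⟩
  · rw [weight_symm w j k, weight_of_lt w hij, weight_of_lt w hkl, weight_of_lt w h1,
      weight_of_lt w h2, weight_of_lt w h3, weight_of_lt w (hij.trans h3)]
    simp only [det₂]
    ring
  · rw [weight_symm w j k, weight_symm w i k, weight_symm w j l, weight_of_lt w hij,
      weight_of_lt w hkl, weight_of_lt w h1,
      weight_of_lt w h2, weight_of_lt w h3, weight_of_lt w (h1.trans hij)]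
    simp only [det₂]
    ring

theorem isSide_univ_add_one [NeZero n] (hn : 3 ≤ n) (i : Fin n) : IsSide univ i (i + 1) := by
  have hi := i.2
  have h1 : ((1 : Fin n) : ℕ) = 1 := by
    rw [Fin.val_one', Nat.mod_eq_of_lt (by omega)]
  have hv : ((i + 1 : Fin n) : ℕ) = if (i : ℕ) + 1 = n then 0 else (i : ℕ) + 1 := by
    rw [Fin.val_add, h1]
    split_ifs with h
    · rw [h, Nat.mod_self]
    · exact Nat.mod_eq_of_lt (by omega)
  split_ifs at hv with h
  · have hlt : i + 1 < i := by rw [Fin.lt_def, hv]; omega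
    refine ((isSide_iff_of_lt hlt).2 ⟨mem_univ _, mem_univ _, .inr fun k _ => ?_⟩).symm
    have := k.2
    simp only [Fin.le_def]
    omega
  · have hlt : i < i + 1 := by rw [Fin.lt_def, hv]; omega
    refine (isSide_iff_of_lt hlt).2 ⟨mem_univ _, mem_univ _, .inl fun k _ => ?_⟩
    simp only [Fin.le_def]
    omega

theorem IsModel.isFrieze [NeZero n] (hn : 3 ≤ n) {w : Fin n → ℤ√2 × ℤ√2}
    (hw : IsModel D univ w) : IsFrieze (weight w) := by
  have hne : ∀ {i j}, i < j → weight w i j ≠ 0 := fun {i j} hij h => by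
    have := hw.pos i (mem_univ i) j (mem_univ j) hij
    rw [← weight_of_lt w hij, h, map_zero] at this
    exact lt_irrefl _ this
  have hside : ∀ i j, IsSide univ i j → weight w i j = 1 := fun i j h => by
    rcases lt_or_gt_of_ne h.2.2.1 with hij | hij
    · rw [weight_of_lt w hij, hw.one i (mem_univ i) j (mem_univ j) hij (.inl h)]
    · rw [weight_symm, weight_of_lt w hij, hw.one j (mem_univ j) i (mem_univ i) hij (.inl h.symm)]
  refine ⟨fun i j => ⟨fun h => ?_, fun h => h ▸ weight_self w i⟩,
    fun i => hside _ _ (isSide_univ_add_one hn i), fun i => ?_, weight_symm w, weight_ptolemy w⟩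
  · by_contra hij
    rcases lt_or_gt_of_ne hij with hij | hij
    · exact hne hij h
    · exact hne hij (weight_symm w i j ▸ h)
  · have := hside _ _ (isSide_univ_add_one hn (i - 1)).symm
    rwa [sub_add_cancel] at this

theorem IsFrieze.map {R R' : Type*} [CommRing R] [IsDomain R] [CommRing R'] [IsDomain R'] [NeZero n]
    {f : Fin n → Fin n → R} (hf : IsFrieze f) (φ : R →+* R') (hφ : Function.Injective φ) :
    IsFrieze fun i j => φ (f i j) where
  eq_zero_iff i j := by rw [map_eq_zero_iff φ hφ, hf.eq_zero_iff]
  boundary_succ i := by rw [hf.boundary_succ, map_one]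
  boundary_pred i := by rw [hf.boundary_pred, map_one]
  symm i j := by rw [hf.symm]
  ptolemy i j k l h := by
    rw [← map_mul, hf.ptolemy i j k l h, map_add, map_mul, map_mul]

theorem euclideanWeight_zero (p : ℕ) : euclideanWeight p 0 = 0 := by
  simp [euclideanWeight]

theorem euclideanWeight_one (p : ℕ) : euclideanWeight p 1 = 1 := by
  simp [euclideanWeight]

theorem euclideanWeight_two (p : ℕ) : euclideanWeight p 2 = 2 * Real.cos (Real.pi / p) := by
  norm_num [euclideanWeight]

theorem euclideanWeight_three (p : ℕ) :
    euclideanWeight p 3 = (2 * Real.cos (Real.pi / p)) ^ 2 - 1 := by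
  norm_num [euclideanWeight, Polynomial.Chebyshev.S_two]

/-- The second case is the wrap-around side, whose ends hold the first and last positions. -/
theorem card_filter_of_isSide (hij : i < j) (h : IsSide S i j) :
    (S.filter fun v => i ≤ v ∧ v < j).card = 1 ∨
      (S.filter fun v => i ≤ v ∧ v < j).card = S.card - 1 := by
  rw [isSide_iff_of_lt hij] at h
  obtain ⟨hi, hj, h | h⟩ := h
  · left
    rw [card_eq_one]
    refine ⟨i, ?_⟩
    ext v
    simp only [mem_filter, mem_singleton]
    refine ⟨fun hv => ?_, fun hv => ?_⟩
    · have := h v hv.1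
      omega
    · subst hv
      exact ⟨hi, le_rfl, hij⟩
  · right
    rw [← card_erase_of_mem hj]
    congr 1
    ext v
    simp only [mem_filter, mem_erase]
    refine ⟨fun hv => ⟨hv.2.2.ne, hv.1⟩, fun hv => ?_⟩
    have := h v hv.2
    exact ⟨hv.2, this.1, lt_of_le_of_ne this.2 hv.1⟩

theorem card_filter_of_isDiagonal (hij : i < j) (h : IsDiagonal S i j) :
    2 ≤ (S.filter fun v => i ≤ v ∧ v < j).card ∧
      (S.filter fun v => i ≤ v ∧ v < j).card + 2 ≤ S.card := by
  obtain ⟨hi, hj, k, hk, l, hl, hx⟩ := h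
  wlog hk' : i < k ∧ k < j ∧ (l < i ∨ j < l) generalizing k l
  · refine this l hl k hk hx.swap_right ?_
    rw [crosses_of_lt hij] at hx
    tauto
  have h1 : ({i, k} : Finset (Fin n)) ⊆ S.filter fun v => i ≤ v ∧ v < j := by
    intro v hv
    simp only [mem_insert, mem_singleton] at hv
    rcases hv with rfl | rfl
    · exact mem_filter.2 ⟨hi, le_rfl, hij⟩
    · exact mem_filter.2 ⟨hk, hk'.1.le, hk'.2.1⟩
  have h2 : ({j, l} : Finset (Fin n)) ⊆ S.filter fun v => ¬ (i ≤ v ∧ v < j) := by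
    intro v hv
    simp only [mem_insert, mem_singleton] at hv
    rcases hv with rfl | rfl
    · exact mem_filter.2 ⟨hj, by omega⟩
    · exact mem_filter.2 ⟨hl, by omega⟩
  have c1 := card_le_card h1
  have c2 := card_le_card h2
  rw [card_pair hk'.1.ne] at c1
  rw [card_pair hx.ne.2.2.2.2.2] at c2
  have := card_filter_add_card_filter_not (s := S) (fun v => i ≤ v ∧ v < j)
  omega

theorem IsModel.isFriezeFromDissection [NeZero n] (hn : 3 ≤ n)
    (hc : ∀ R, IsPiece D univ R → R.card = 3 ∨ R.card = 4)
    {w : Fin n → ℤ√2 × ℤ√2} (hw : IsModel D univ w) :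
    IsFriezeFromDissection D fun i j => sqrtTwoToReal (weight w i j) := by
  refine ⟨(hw.isFrieze hn).map _ sqrtTwoToReal_injective, fun S hS i hi j hj hij => ?_⟩
  change sqrtTwoToReal (weight w i j) = _
  rcases hij.eq_or_lt with rfl | hij
  · have : (S.filter fun v => i ≤ v ∧ v < i) = ∅ := filter_false_of_mem fun v _ => by omega
    rw [weight_self, map_zero, this, card_empty, euclideanWeight_zero]
  rw [weight_of_lt w hij]
  have hc := hc S hS
  by_cases h : IsDiagonal S i j
  · have hd := card_filter_of_isDiagonal hij h
    have h4 : S.card = 4 := by omega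
    have h2 : (S.filter fun v => i ≤ v ∧ v < j).card = 2 := by omega
    rw [hw.diagonal S hS i (mem_univ i) j (mem_univ j) hij h, sqrtTwoToReal_rootTwo, h2, h4,
      euclideanWeight_two]
    norm_num [Real.cos_pi_div_four]
    ring
  · have h := isSide_of_not_isDiagonal hi hj hij.ne h
    rw [hw.one i (mem_univ i) j (mem_univ j) hij (hS.side i j h), map_one]
    -- A side at distance `p - 1` also has weight 1: `U₁(1) = 1` for the triangle and `U₂(√2) = 2 -
    -- 1` for the quadrilateral.
    rcases card_filter_of_isSide hij h with hd | hd
    · rw [hd, euclideanWeight_one]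
    · rcases hc with h3 | h4
      · rw [hd, h3, euclideanWeight_two]
        norm_num [Real.cos_pi_div_three]
      · rw [hd, h4, euclideanWeight_three]
        norm_num [Real.cos_pi_div_four, mul_pow, div_pow]

/-- Cut along an arc `(a, b)` of `D`. If `(i, j)` crosses it, Ptolemy writes `f i j * f a b` through
values in the two halves, where `f` and `g` agree by induction, and the common value at `(a, b)` is
nonzero. -/
theorem IsFriezeFromDissection.eqOn [NeZero n] {f g : Fin n → Fin n → ℝ}
    (hf : IsFriezeFromDissection D f) (hg : IsFriezeFromDissection D g) (hS : IsSubpolygon D S) :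
    ∀ i ∈ S, ∀ j ∈ S, f i j = g i j := by
  induction hm : S.card using Nat.strong_induction_on generalizing S with
  | _ m ih =>
    subst hm
    intro i hi j hj
    by_cases h : ∀ i j, IsDiagonal S i j → ¬ D.Adj i j
    · have hP := hS.isPiece h
      rcases le_total i j with hij | hij
      · rw [hf.2 S hP i hi j hj hij, hg.2 S hP i hi j hj hij]
      · rw [hf.1.symm, hg.1.symm, hf.2 S hP j hj i hi hij, hg.2 S hP j hj i hi hij]
    push Not at h
    obtain ⟨a, b, hd, hab⟩ := h
    obtain ⟨r, hr, hra, hrb⟩ := hd.exists_third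
    have h₁ := ih _ (card_near_lt hd hra hrb) (hS.near hab hd.1 hd.2.1 hr hra hrb) rfl
    have h₂ := ih _ (card_far_lt hr hra hrb) (hS.far hab hd hra hrb) rfl
    have ha₁ : a ∈ near S a b r := left_mem_near hd.1
    have hb₁ : b ∈ near S a b r := right_mem_near hd.2.1
    have ha₂ : a ∈ far S a b r := left_mem_far hd.1
    have hb₂ : b ∈ far S a b r := right_mem_far hd.2.1
    by_cases hx : Crosses i j a b
    · have hne : g a b ≠ 0 := fun h0 => hab.ne ((hg.1.eq_zero_iff a b).1 h0)
      have h' : (∀ x ∈ ({i, j} : Finset (Fin n)), ∀ y ∈ ({a, b} : Finset (Fin n)),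
          f x y = g x y) := by
        simp only [mem_insert, mem_singleton]
        rintro x hx y hy
        have hxS : x ∈ S := by rcases hx with rfl | rfl <;> assumption
        rcases near_or_far (a := a) (b := b) (r := r) x hxS with h | h
        · exact h₁ x h y (by rcases hy with rfl | rfl <;> assumption)
        · exact h₂ x h y (by rcases hy with rfl | rfl <;> assumption)
      have e1 := hf.1.ptolemy i j a b hx
      have e2 := hg.1.ptolemy i j a b hx
      rw [h' i (by simp) b (by simp), h' j (by simp) b (by simp), h' i (by simp) a (by simp),
        h' j (by simp) a (by simp), ← e2, h₁ a ha₁ b hb₁] at e1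
      exact mul_right_cancel₀ hne e1
    · have hsub : ({i, j} : Finset (Fin n)) ⊆ S := by
        intro v hv
        simp only [mem_insert, mem_singleton] at hv
        rcases hv with rfl | rfl <;> assumption
      have hnc : ∀ x ∈ ({i, j} : Finset (Fin n)), ∀ y ∈ ({i, j} : Finset (Fin n)),
          ¬ Crosses a b x y := by
        simp only [mem_insert, mem_singleton]
        rintro x (rfl | rfl) y (rfl | rfl) h
        · exact h.ne.2.1 rfl
        · exact hx h.symm
        · exact hx h.symm.swap
        · exact h.ne.2.1 rfl
      rcases subset_near_or_far (r := r) hsub hnc with h | h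
      · exact h₁ i (h (by simp)) j (h (by simp))
      · exact h₂ i (h (by simp)) j (h (by simp))

end Frieze

/-! ### Crossings seen from a roof point -/

section TowerCrossing

variable {n : ℕ} {a b c d i j k l r s t u v w x y z : Fin n}

theorem Crosses.not_crosses_of_crosses (hk : Crosses a b r k) (hl : Crosses a b r l) :
    ¬ Crosses a b k l := by
  intro h
  rcases lt_or_gt_of_ne h.ne.1 with h1 | h1 <;>
    simp only [crosses_of_lt, crosses_of_gt, h1] at h hk hl <;> omega

theorem Crosses.not_crosses_pairing (h : Crosses a c b d) : ¬ Crosses b c a d := by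
  intro h'
  rcases lt_or_gt_of_ne h.ne.1 with h1 | h1 <;> rcases lt_or_gt_of_ne h'.ne.1 with h2 | h2 <;>
    simp only [crosses_of_lt, crosses_of_gt, h1, h2] at h h' <;> omega

theorem Crosses.beyond (h : Crosses c d r v) (hab : a ≠ b)
    (hc : c = a ∨ c = b ∨ Crosses a b r c) (hd : d = a ∨ d = b ∨ Crosses a b r d) :
    v = a ∨ v = b ∨ Crosses a b r v := by
  rcases lt_or_gt_of_ne h.ne.1 with h1 | h1 <;> rcases lt_or_gt_of_ne hab with h2 | h2 <;>
    simp only [crosses_of_lt, crosses_of_gt, h1, h2] at h hc hd ⊢ <;> omega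

/-- Applied with `(b, c)` a side of the quadrilateral behind `(a, b)`: an arc of `D` that meets the
side `(r, b)` of the triangle `r, b, c` and cannot leave through `(b, c)` leaves through `(r, c)`.
`Crosses.restrict` is the converse, except for arcs that end at `b`. -/
theorem Crosses.extend (h : Crosses r b x y) (hc : Crosses a b r c) (h1 : ¬ Crosses a b x y)
    (h2 : ¬ Crosses b c x y) : Crosses r c x y := by
  rw [crosses_symm]
  replace h := h.symm
  rw [crosses_symm] at h2
  rcases lt_or_gt_of_ne h.ne.1 with h3 | h3 <;> rcases lt_or_gt_of_ne hc.ne.1 with h4 | h4 <;>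
    simp only [crosses_of_lt, crosses_of_gt, h3, h4] at h h1 h2 hc ⊢ <;> omega

theorem Crosses.restrict (h : Crosses r c x y) (hc : Crosses a b r c) (h2 : ¬ Crosses b c x y)
    (hx : x ≠ b) (hy : y ≠ b) : Crosses r b x y := by
  rw [crosses_symm]
  replace h := h.symm
  rw [crosses_symm] at h2
  have := hc.ne
  rcases lt_or_gt_of_ne h.ne.1 with h3 | h3 <;>
    simp only [crosses_of_lt, crosses_of_gt, h3] at h h2 ⊢ <;> omega

theorem Crosses.near_diagonal (h : Crosses a b r c) (h1 : Crosses b y r c)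
    (h2 : ¬ Crosses a b r y) (hy : y ≠ a) : Crosses b y r a := by
  rcases lt_or_gt_of_ne h.ne.1 with h3 | h3 <;> rcases lt_or_gt_of_ne h1.ne.1 with h4 | h4 <;>
    simp only [crosses_of_lt, crosses_of_gt, h3, h4, true_and, and_true, true_or, or_true]
      at h h1 h2 ⊢ <;> omega

end TowerCrossing

/-! ### Peeling quadrilaterals off a tower -/

section Towers

open Finset

variable {n : ℕ} {S R R₁ R₂ B Q : Finset (Fin n)} {i j a b c d r v x y t : Fin n}
  {D E : SimpleGraph (Fin n)}

theorem card_four_of_ne (hab : a ≠ b) (hac : a ≠ c) (had : a ≠ d) (hbc : b ≠ c) (hbd : b ≠ d)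
    (hcd : c ≠ d) (ha : a ∈ S) (hb : b ∈ S) (hc : c ∈ S) (hd : d ∈ S) : 4 ≤ S.card := by
  have hsub : ({a, b, c, d} : Finset (Fin n)) ⊆ S := by
    intro v hv
    simp only [mem_insert, mem_singleton] at hv
    rcases hv with rfl | rfl | rfl | rfl <;> assumption
  have := card_le_card hsub
  rwa [card_insert_of_notMem, card_insert_of_notMem, card_insert_of_notMem, card_singleton] at this
  · simpa using hcd
  · simp [hbc, hbd]
  · simp [hab, hac, had]

theorem not_isDiagonal_of_card_eq_three (h : S.card = 3) : ¬ IsDiagonal S a b := by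
  rintro ⟨ha, hb, k, hk, l, hl, hx⟩
  obtain ⟨h1, h2, h3, h4, h5, h6⟩ := hx.ne
  have := card_four_of_ne h1 h3 h4 h5 h6 h2 ha hb hk hl
  omega

theorem isSide_near (ha : a ∈ S) (hb : b ∈ S) (hab : a ≠ b) (hra : r ≠ a) (hrb : r ≠ b) :
    IsSide (near S a b r) a b := by
  refine ⟨left_mem_near ha, right_mem_near hb, hab, fun k hk l hl hx => ?_⟩
  rcases hx.trans_left hra hrb with h | h
  · exact (mem_near.1 hk).2 h
  · exact (mem_near.1 hl).2 h

theorem isSide_far (ha : a ∈ S) (hb : b ∈ S) (hab : a ≠ b) : IsSide (far S a b r) a b := by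
  refine ⟨left_mem_far ha, right_mem_far hb, hab, fun k hk l hl hx => ?_⟩
  have hne := hx.ne
  have hk' := ((mem_far.1 hk).2.resolve_left hne.2.2.1.symm).resolve_left hne.2.2.2.2.1.symm
  have hl' := ((mem_far.1 hl).2.resolve_left hne.2.2.2.1.symm).resolve_left hne.2.2.2.2.2.symm
  exact hk'.not_crosses_of_crosses hl' hx

theorem eq_or_eq_of_mem_near_of_mem_far (h₁ : v ∈ near S a b r) (h₂ : v ∈ far S a b r) :
    v = a ∨ v = b := by
  have := (mem_near.1 h₁).2
  have := (mem_far.1 h₂).2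
  tauto

theorem ne_of_subset_near_of_subset_far (h₁ : R₁ ⊆ near S a b r) (h₂ : R₂ ⊆ far S a b r)
    (hc : 3 ≤ R₁.card) : R₁ ≠ R₂ := by
  rintro rfl
  obtain ⟨u, hu, hua, hub⟩ := exists_mem_ne_ne hc a b
  exact (eq_or_eq_of_mem_near_of_mem_far (h₁ hu) (h₂ hu)).elim hua hub

/-- The pieces on the two sides of an arc of `D`. -/
theorem IsSubpolygon.exists_two_pieces (hS : IsSubpolygon D S) (hab : D.Adj a b)
    (hd : IsDiagonal S a b) (hr : r ∈ S) (hra : r ≠ a) (hrb : r ≠ b) :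
    ∃ R₁ R₂, IsPiece D univ R₁ ∧ IsPiece D univ R₂ ∧ a ∈ R₁ ∧ a ∈ R₂ ∧
      R₁ ⊆ PolygonFrieze.near S a b r ∧ R₂ ⊆ PolygonFrieze.far S a b r := by
  obtain ⟨R₁, h1, h2, h3⟩ := (hS.near hab hd.1 hd.2.1 hr hra hrb).exists_isPiece_mem
    (left_mem_near hd.1)
  obtain ⟨R₂, h4, h5, h6⟩ := (hS.far hab hd hra hrb).exists_isPiece_mem (left_mem_far hd.1)
  exact ⟨R₁, R₂, h1, h4, h2, h5, h3, h6⟩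

/-- In a quadrilateral, a vertex not on the side `(a, b)` is joined by a side to one of `a` and `b`
and by a diagonal to the other one. -/
theorem isSide_and_isDiagonal_of_card_eq_four (h4 : B.card = 4) (hab : IsSide B a b) (hc : c ∈ B)
    (hca : c ≠ a) (hcb : c ≠ b) :
    IsSide B b c ∧ IsDiagonal B a c ∨ IsSide B a c ∧ IsDiagonal B b c := by
  obtain ⟨d, hd, hd'⟩ : ∃ d ∈ B, d ∉ ({a, b, c} : Finset (Fin n)) := by
    by_contra! h
    have := card_le_card (show B ⊆ {a, b, c} from h)
    have := this.trans card_le_three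
    omega
  simp only [mem_insert, mem_singleton, not_or] at hd'
  obtain ⟨hda : d ≠ a, hdb : d ≠ b, hdc : d ≠ c⟩ := hd'
  have ha := hab.1
  have hb := hab.2.1
  have hne := hab.2.2.1
  have hB : ∀ v ∈ B, v = a ∨ v = b ∨ v = c ∨ v = d := by
    have hsub : ({a, b, c, d} : Finset (Fin n)) ⊆ B := by
      intro v hv
      simp only [mem_insert, mem_singleton] at hv
      rcases hv with rfl | rfl | rfl | rfl <;> assumption
    have hcard : ({a, b, c, d} : Finset (Fin n)).card = 4 := by
      rw [card_insert_of_notMem, card_insert_of_notMem, card_insert_of_notMem, card_singleton]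
      · simpa using hdc.symm
      · simp [hcb.symm, hdb.symm]
      · simp [hne, hca.symm, hda.symm]
    have := eq_of_subset_of_card_le hsub (by omega)
    intro v hv
    rw [← this] at hv
    simpa using hv
  rcases crosses_of_ne hne hca.symm hda.symm hcb.symm hdb.symm hdc.symm with h | h | h
  · exact absurd h (hab.2.2.2 c hc d hd)
  · refine .inl ⟨⟨hb, hc, hcb.symm, fun k hk l hl hx => ?_⟩, ha, hc, b, hb, d, hd, h⟩
    have hxn := hx.ne
    have h0 := h.not_crosses_pairing
    rcases hB k hk with rfl | rfl | rfl | rfl <;> rcases hB l hl with rfl | rfl | rfl | rfl <;>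
      first | exact h0 hx | exact h0 hx.swap_right | simp at hxn
  · refine .inr ⟨⟨ha, hc, hca.symm, fun k hk l hl hx => ?_⟩, hb, hc, a, ha, d, hd, h.symm⟩
    have hxn := hx.ne
    have h0 := h.symm.not_crosses_pairing
    rcases hB k hk with rfl | rfl | rfl | rfl <;> rcases hB l hl with rfl | rfl | rfl | rfl <;>
      first | exact h0 hx | exact h0 hx.swap_right | simp at hxn

/-- Of three chords at `b`, one separates the ends of the other two. -/
theorem not_three_sides (ha : IsSide B b a) (hc : IsSide B b c) (hy : IsSide B b y) (hac : a ≠ c)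
    (hay : a ≠ y) (hcy : c ≠ y) : False := by
  rcases crosses_of_ne ha.2.2.1 hc.2.2.1 hy.2.2.1 hac hay hcy with h | h | h
  · exact ha.2.2.2 c hc.2.1 y hy.2.1 h
  · exact hc.2.2.2 a ha.2.1 y hy.2.1 h
  · exact hy.2.2.2 a ha.2.1 c hc.2.1 h

/-- A subpolygon divided by `D` into triangles and quadrilaterals like a tower with roof `r`. -/
structure IsRoofed (D : SimpleGraph (Fin n)) (S : Finset (Fin n)) (r : Fin n) : Prop where
  isSubpolygon : IsSubpolygon D S
  mem : r ∈ S
  card_piece : ∀ R, IsPiece D univ R → R ⊆ S → R.card = 3 ∨ R.card = 4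
  triangle : ∀ R R', IsPiece D univ R → IsPiece D univ R' → R ⊆ S → R' ⊆ S → R.card = 3 →
    R'.card = 3 → R = R'
  roof : ∀ R, IsPiece D univ R → R ⊆ S → r ∈ R → R.card = 3
  incident : ∀ v, {R | IsPiece D univ R ∧ R ⊆ S ∧ v ∈ R}.ncard ≤ 2

theorem not_three_pieces {R₃ : Finset (Fin n)}
    (h : {R | IsPiece D univ R ∧ R ⊆ S ∧ v ∈ R}.ncard ≤ 2) (h₁ : IsPiece D univ R₁)
    (h₂ : IsPiece D univ R₂) (h₃ : IsPiece D univ R₃) (hS₁ : R₁ ⊆ S) (hS₂ : R₂ ⊆ S) (hS₃ : R₃ ⊆ S)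
    (hv₁ : v ∈ R₁) (hv₂ : v ∈ R₂) (hv₃ : v ∈ R₃) (h12 : R₁ ≠ R₂) (h13 : R₁ ≠ R₃) (h23 : R₂ ≠ R₃) :
    False := by
  rw [← not_lt, Set.two_lt_ncard] at h
  exact h ⟨R₁, ⟨h₁, hS₁, hv₁⟩, R₂, ⟨h₂, hS₂, hv₂⟩, R₃, ⟨h₃, hS₃, hv₃⟩, h12, h13, h23⟩

/-- The exact counts in `IsTower` do not pass to a smaller subpolygon; these conditions do, which
permits induction. -/
theorem IsRoofed.of_subset (h : IsRoofed D S r) (hR : IsSubpolygon D R) (hRS : R ⊆ S)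
    (hr : r ∈ R) : IsRoofed D R r where
  isSubpolygon := hR
  mem := hr
  card_piece A hA hAR := h.card_piece A hA (hAR.trans hRS)
  triangle A A' hA hA' hAR hA'R := h.triangle A A' hA hA' (hAR.trans hRS) (hA'R.trans hRS)
  roof A hA hAR := h.roof A hA (hAR.trans hRS)
  incident v := by
    refine (Set.ncard_le_ncard ?_ (Set.toFinite _)).trans (h.incident v)
    exact fun _ hA => ⟨hA.1, hA.2.1.trans hRS, hA.2.2⟩

/-- An arc of `D` at the roof would have a piece at the roof on each side; both would be triangles,
but there is only one triangle. -/
theorem IsRoofed.ne_of_isDiagonal (h : IsRoofed D S r) (hab : D.Adj a b) (hd : IsDiagonal S a b) :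
    r ≠ a := by
  rintro rfl
  obtain ⟨t, ht, hta, htb⟩ := hd.exists_third
  obtain ⟨R₁, R₂, h1, h2, ha1, ha2, hs1, hs2⟩ :=
    h.isSubpolygon.exists_two_pieces hab hd ht hta htb
  have hs1' := hs1.trans near_subset
  have hs2' := hs2.trans far_subset
  exact ne_of_subset_near_of_subset_far hs1 hs2 h1.three_le_card
    (h.triangle R₁ R₂ h1 h2 hs1' hs2' (h.roof R₁ h1 hs1' ha1) (h.roof R₂ h2 hs2' ha2))

/-- Unless `S` is a piece, an arc of `D` cuts off a piece not containing `r`. -/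
theorem IsRoofed.exists_leaf (h : IsRoofed D S r) (hab : D.Adj a b) (hd : IsDiagonal S a b) :
    ∃ a b, D.Adj a b ∧ IsDiagonal S a b ∧ IsPiece D univ (far S a b r) := by
  induction hm : (far S a b r).card using Nat.strong_induction_on generalizing a b with
  | _ m ih =>
    subst hm
    have hra := h.ne_of_isDiagonal hab hd
    have hrb := h.ne_of_isDiagonal hab.symm hd.symm
    by_cases hp : ∀ i j, IsDiagonal (far S a b r) i j → ¬ D.Adj i j
    · exact ⟨a, b, hab, hd, (h.isSubpolygon.far hab hd hra hrb).isPiece hp⟩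
    push Not at hp
    obtain ⟨c, d, hcd, hadj⟩ := hp
    -- An arc of `D` inside the far half cuts off a strictly smaller far half.
    refine ih _ (card_lt_card ⟨fun v hv => ?_, fun hsub => ?_⟩) hadj (hcd.mono far_subset) rfl
    · obtain ⟨hvS, hv⟩ := mem_far.1 hv
      rcases hv with rfl | rfl | hv
      · exact hcd.1
      · exact hcd.2.1
      · exact mem_far.2 ⟨hvS, hv.beyond hab.ne (mem_far.1 hcd.1).2 (mem_far.1 hcd.2.1).2⟩
    · obtain ⟨_, _, k, hk, l, hl, hx⟩ := hcd
      have hne := hx.ne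
      have hk' := ((mem_far.1 (hsub hk)).2.resolve_left hne.2.2.1.symm).resolve_left
        hne.2.2.2.2.1.symm
      have hl' := ((mem_far.1 (hsub hl)).2.resolve_left hne.2.2.2.1.symm).resolve_left
        hne.2.2.2.2.2.symm
      exact hk'.not_crosses_of_crosses hl' hx

/-- The only triangle is the piece at `r`, and `r` is not in the leaf. -/
theorem IsRoofed.card_leaf (h : IsRoofed D S r) (hra : r ≠ a) (hrb : r ≠ b)
    (hp : IsPiece D univ (far S a b r)) : (far S a b r).card = 4 := by
  refine (h.card_piece _ hp far_subset).resolve_left fun h3 => ?_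
  obtain ⟨R, hR, hrR, hRS⟩ := h.isSubpolygon.exists_isPiece_mem h.mem
  have := h.triangle R _ hR hp hRS far_subset (h.roof R hR hRS hrR) h3
  exact self_not_mem_far hra hrb (this ▸ hrR)

theorem crossingNumber_eq_zero (h : ∀ x y, D.Adj x y → ¬ Crosses a b x y) :
    crossingNumber D a b = 0 := by
  rw [crossingNumber, Set.ncard_eq_zero]
  ext e
  simpa using fun _ he => h _ _ he

theorem crossingNumber_eq_add_one (hab : D.Adj a b) (hn : ¬ Crosses r b a b)
    (h : ∀ x y, D.Adj x y →
      (Crosses r c x y ↔ (x = a ∧ y = b ∨ x = b ∧ y = a) ∨ Crosses r b x y)) :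
    crossingNumber D r c = crossingNumber D r b + 1 := by
  have hne := hab.ne
  rw [crossingNumber, crossingNumber, ← Set.ncard_insert_of_notMem (a := (min a b, max a b))]
  · congr 1
    ext ⟨x, y⟩
    simp only [Set.mem_insert_iff, Set.mem_ofPred_eq, Prod.mk.injEq]
    constructor
    · rintro ⟨hxy, hadj, hx⟩
      rcases (h x y hadj).1 hx with (⟨rfl, rfl⟩ | ⟨rfl, rfl⟩) | hx
      · exact .inl ⟨(min_eq_left hxy.le).symm, (max_eq_right hxy.le).symm⟩
      · exact .inl ⟨(min_eq_right hxy.le).symm, (max_eq_left hxy.le).symm⟩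
      · exact .inr ⟨hxy, hadj, hx⟩
    · rintro (⟨rfl, rfl⟩ | ⟨hxy, hadj, hx⟩)
      · refine ⟨min_lt_max.2 hne, ?_⟩
        rcases lt_or_gt_of_ne hne with hlt | hlt
        · rw [min_eq_left hlt.le, max_eq_right hlt.le]
          exact ⟨hab, (h a b hab).2 (.inl (.inl ⟨rfl, rfl⟩))⟩
        · rw [min_eq_right hlt.le, max_eq_left hlt.le]
          exact ⟨hab.symm, (h b a hab.symm).2 (.inl (.inr ⟨rfl, rfl⟩))⟩
      · exact ⟨hxy, hadj, (h x y hadj).2 (.inr hx)⟩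
  · rintro ⟨-, -, hx⟩
    rcases lt_or_gt_of_ne hne with hlt | hlt
    · simp only [min_eq_left hlt.le, max_eq_right hlt.le] at hx
      exact hn hx
    · simp only [min_eq_right hlt.le, max_eq_left hlt.le] at hx
      exact hn hx.swap_right

theorem IsSubpolygon.not_crosses_of_isSide (hD : IsDissection D) (hS : IsSubpolygon D S)
    (h : IsSide S a b) (hxy : D.Adj x y) : ¬ Crosses a b x y := fun hx => by
  rcases hS.2 a b h with h | h
  · exact not_isSide_univ hx h
  · exact hD.2 a b x y h hxy hx

/-- Suppose `y ≠ a`. If `y` is on the side of `r`, the arc `(b, y)` creates two pieces at `b`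
besides the leaf, one too many. If `y` is in the leaf, then `(b, y)` is a third side of the leaf at
`b`. -/
theorem IsRoofed.left_eq_of_crosses (hD : IsDissection D) (h : IsRoofed D S r) (hab : D.Adj a b)
    (hd : IsDiagonal S a b) (hp : IsPiece D univ (far S a b r)) (hbc : IsSide (far S a b r) b c)
    (hca : c ≠ a) (hy : D.Adj b y) (hx : Crosses r c b y) : y = a := by
  by_contra hya
  have hra := h.ne_of_isDiagonal hab hd
  have hrb := h.ne_of_isDiagonal hab.symm hd.symm
  have hc : Crosses a b r c :=
    ((mem_far.1 hbc.2.1).2.resolve_left hca).resolve_left hbc.2.2.1.symm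
  have hyS := (h.isSubpolygon.isDiagonal_of_crosses hD hy hx.symm h.mem (far_subset hbc.2.1)).2.1
  rcases near_or_far (a := a) (b := b) (r := r) y hyS with hyn | hyf
  · have hx' := hc.near_diagonal hx.symm (mem_near.1 hyn).2 hya
    have hdn : IsDiagonal (near S a b r) b y := ⟨right_mem_near hd.2.1, hyn, r,
      self_mem_near h.mem, a, left_mem_near hd.1, hx'⟩
    obtain ⟨R₁, R₂, h1, h2, hb1, hb2, hs1, hs2⟩ := IsSubpolygon.exists_two_pieces
      (h.isSubpolygon.near hab hd.1 hd.2.1 h.mem hra hrb) hy hdn (self_mem_near h.mem)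
      hrb hx.ne.2.2.2.1
    have hn1 := hs1.trans near_subset
    have hn2 := hs2.trans far_subset
    exact not_three_pieces (h.incident b) h1 h2 hp (hn1.trans near_subset) (hn2.trans near_subset)
      far_subset hb1 hb2 hbc.1 (ne_of_subset_near_of_subset_far hs1 hs2 h1.three_le_card)
      (ne_of_subset_near_of_subset_far hn1 Subset.rfl h1.three_le_card)
      (ne_of_subset_near_of_subset_far hn2 Subset.rfl h2.three_le_card)
  · have hside := isSide_of_not_isDiagonal hbc.1 hyf hy.ne fun h => hp.not_adj _ _ h hy
    exact not_three_sides (isSide_far hd.1 hd.2.1 hab.ne).symm hbc hside hca.symm (Ne.symm hya)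
      hx.ne.2.2.2.2.2

theorem IsRoofed.crossingNumber_leaf (hD : IsDissection D) (h : IsRoofed D S r) (hab : D.Adj a b)
    (hd : IsDiagonal S a b) (hp : IsPiece D univ (far S a b r)) (hbc : IsSide (far S a b r) b c)
    (hca : c ≠ a) : crossingNumber D r c = crossingNumber D r b + 1 := by
  have hc : Crosses a b r c :=
    ((mem_far.1 hbc.2.1).2.resolve_left hca).resolve_left hbc.2.2.1.symm
  refine crossingNumber_eq_add_one hab (fun h => h.ne.2.2.2.2.2 rfl)
    fun x y hxy => ⟨fun hx => ?_, ?_⟩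
  · by_cases hxb : x = b
    · subst hxb
      exact .inl (.inr ⟨rfl, h.left_eq_of_crosses hD hab hd hp hbc hca hxy hx⟩)
    by_cases hyb : y = b
    · subst hyb
      exact .inl (.inl ⟨h.left_eq_of_crosses hD hab hd hp hbc hca hxy.symm hx.swap_right, rfl⟩)
    exact .inr (hx.restrict hc (hp.isSubpolygon.not_crosses_of_isSide hD hbc hxy) hxb hyb)
  · rintro ((⟨rfl, rfl⟩ | ⟨rfl, rfl⟩) | hx)
    · exact hc.symm
    · exact hc.symm.swap_right
    · exact hx.extend hc (hD.2 a b x y hab hxy)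
        (hp.isSubpolygon.not_crosses_of_isSide hD hbc hxy)

theorem IsModel.weight_eq_one {w : Fin n → ℤ√2 × ℤ√2} (hw : IsModel D univ w)
    (h : IsSide univ i j ∨ D.Adj i j) : weight w i j = 1 := by
  have hne : i ≠ j := h.elim (fun h => h.2.2.1) fun h => h.ne
  rcases lt_or_gt_of_ne hne with hij | hij
  · rw [weight_of_lt w hij, hw.one i (mem_univ i) j (mem_univ j) hij h]
  · rw [weight_symm, weight_of_lt w hij, hw.one j (mem_univ j) i (mem_univ i) hij
      (h.imp IsSide.symm SimpleGraph.Adj.symm)]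

theorem IsModel.weight_eq_rootTwo {w : Fin n → ℤ√2 × ℤ√2} (hw : IsModel D univ w)
    (hR : IsPiece D univ R) (h : IsDiagonal R i j) : weight w i j = rootTwo := by
  rcases lt_or_gt_of_ne h.ne with hij | hij
  · rw [weight_of_lt w hij, hw.diagonal R hR i (mem_univ i) j (mem_univ j) hij h]
  · rw [weight_symm, weight_of_lt w hij, hw.diagonal R hR j (mem_univ j) i (mem_univ i) hij h.symm]

/-- With `λ = 1 + √2`, Ptolemy for `(r, c)` and `(a, b)` reads `f r c * 1 = λ ^ k * √2 + λ ^ k * 1`.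
-/
theorem IsRoofed.weight_leaf_of_isSide (hD : IsDissection D) {w : Fin n → ℤ√2 × ℤ√2}
    (hw : IsModel D univ w) (h : IsRoofed D S r) (hab : D.Adj a b)
    (hd : IsDiagonal S a b) (hp : IsPiece D univ (far S a b r)) {k : ℕ}
    (hbc : IsSide (far S a b r) b c) (hac : IsDiagonal (far S a b r) a c)
    (hkb : crossingNumber D r b = k)
    (ha : weight w r a = (⟨1, 1⟩ : ℤ√2) ^ k) (hb : weight w r b = (⟨1, 1⟩ : ℤ√2) ^ k) :
    crossingNumber D r c = k + 1 ∧ weight w r c = (⟨1, 1⟩ : ℤ√2) ^ (k + 1) := by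
  refine ⟨by rw [h.crossingNumber_leaf hD hab hd hp hbc hac.ne.symm, hkb], ?_⟩
  have hc : Crosses a b r c :=
    ((mem_far.1 hbc.2.1).2.resolve_left hac.ne.symm).resolve_left hbc.2.2.1.symm
  have e := weight_ptolemy w r c a b hc.symm
  rw [hw.weight_eq_one (.inr hab), weight_symm w c a, hw.weight_eq_rootTwo hp hac,
    weight_symm w c b, hw.weight_eq_one (hp.side b c hbc), ha, hb] at e
  have : (⟨1, 1⟩ : ℤ√2) = 1 + rootTwo := by decide
  rw [pow_succ]
  linear_combination e - (⟨1, 1⟩ : ℤ√2) ^ k * this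

theorem IsRoofed.weight_leaf (hD : IsDissection D) {w : Fin n → ℤ√2 × ℤ√2}
    (hw : IsModel D univ w) (h : IsRoofed D S r) (hab : D.Adj a b)
    (hd : IsDiagonal S a b) (hp : IsPiece D univ (far S a b r)) {k : ℕ} (hc : c ∈ far S a b r)
    (hca : c ≠ a) (hcb : c ≠ b) (hka : crossingNumber D r a = k) (hkb : crossingNumber D r b = k)
    (ha : weight w r a = (⟨1, 1⟩ : ℤ√2) ^ k) (hb : weight w r b = (⟨1, 1⟩ : ℤ√2) ^ k) :
    crossingNumber D r c = k + 1 ∧ weight w r c = (⟨1, 1⟩ : ℤ√2) ^ (k + 1) := by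
  have h4 := h.card_leaf (h.ne_of_isDiagonal hab hd) (h.ne_of_isDiagonal hab.symm hd.symm) hp
  rcases isSide_and_isDiagonal_of_card_eq_four h4 (isSide_far hd.1 hd.2.1 hab.ne) hc hca hcb with
    ⟨h1, h2⟩ | ⟨h1, h2⟩
  · exact h.weight_leaf_of_isSide hD hw hab hd hp h1 h2 hkb ha hb
  · rw [far_swap] at hp h1 h2
    exact h.weight_leaf_of_isSide hD hw hab.symm hd.symm hp h1 h2 hka hb ha

/-- The second claim is the invariant that drives the induction: a side away from `r` whose ends
each lie in a single piece is a free base of the tower, and both its ends are at the same height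
above the roof arcs. The next quadrilateral can be attached only along such a side. -/
theorem IsRoofed.weights (hD : IsDissection D) {w : Fin n → ℤ√2 × ℤ√2}
    (hw : IsModel D univ w) (h : IsRoofed D S r) :
    (∀ v ∈ S, v ≠ r → weight w r v = (⟨1, 1⟩ : ℤ√2) ^ crossingNumber D r v) ∧
    ∀ x y, IsSide S x y → x ≠ r → y ≠ r →
      (∀ v, v = x ∨ v = y → ∀ R R', IsPiece D univ R → IsPiece D univ R' → R ⊆ S → R' ⊆ S →
        v ∈ R → v ∈ R' → R = R') → crossingNumber D r x = crossingNumber D r y := by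
  induction hm : S.card using Nat.strong_induction_on generalizing S with
  | _ m ih =>
    subst hm
    by_cases hdiv : ∀ i j, IsDiagonal S i j → ¬ D.Adj i j
    · have hP := h.isSubpolygon.isPiece hdiv
      have h0 : ∀ v ∈ S, crossingNumber D r v = 0 := fun v hv =>
        crossingNumber_eq_zero fun x y hxy hx => hP.not_crosses hD hxy h.mem hv hx.symm
      refine ⟨fun v hv hvr => ?_, fun x y hxy _ _ _ => by rw [h0 x hxy.1, h0 y hxy.2.1]⟩
      rw [h0 v hv, pow_zero]
      exact hw.weight_eq_one (hP.side r v (isSide_of_not_isDiagonal h.mem hv hvr.symm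
        (not_isDiagonal_of_card_eq_three (h.roof S hP Subset.rfl h.mem))))
    push Not at hdiv
    obtain ⟨a₀, b₀, hd₀, hab₀⟩ := hdiv
    obtain ⟨a, b, hab, hd, hp⟩ := h.exists_leaf hab₀ hd₀
    have hra := h.ne_of_isDiagonal hab hd
    have hrb := h.ne_of_isDiagonal hab.symm hd.symm
    have hnear := h.of_subset (h.isSubpolygon.near hab hd.1 hd.2.1 h.mem hra hrb) near_subset
      (self_mem_near h.mem)
    obtain ⟨ih1, ih2⟩ := ih _ (card_near_lt hd hra hrb) hnear rfl
    -- Both `a` and `b` already lie in the leaf, so each lies in at most one piece of the near half,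
    -- and the invariant applies to its side `(a, b)`.
    have hk : crossingNumber D r a = crossingNumber D r b := by
      refine ih2 a b (isSide_near hd.1 hd.2.1 hab.ne hra hrb) hra.symm hrb.symm ?_
      intro v hv R R' hR hR' hs hs' hvR hvR'
      by_contra hne
      refine not_three_pieces (h.incident v) hR hR' hp (hs.trans near_subset)
        (hs'.trans near_subset) far_subset hvR hvR' ?_ hne
        (ne_of_subset_near_of_subset_far hs Subset.rfl hR.three_le_card)
        (ne_of_subset_near_of_subset_far hs' Subset.rfl hR'.three_le_card)
      rcases hv with rfl | rfl
      · exact left_mem_far hd.1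
      · exact right_mem_far hd.2.1
    have wa := ih1 a (left_mem_near hd.1) hra.symm
    have wb := ih1 b (right_mem_near hd.2.1) hrb.symm
    rw [hk] at wa
    have hleaf : ∀ c ∈ far S a b r, c ≠ a → c ≠ b →
        crossingNumber D r c = crossingNumber D r b + 1 ∧
          weight w r c = (⟨1, 1⟩ : ℤ√2) ^ (crossingNumber D r b + 1) := fun c hc hca hcb =>
      h.weight_leaf hD hw hab hd hp hc hca hcb hk rfl wa wb
    refine ⟨fun v hv hvr => ?_, fun x y hxy hxr hyr hone => ?_⟩
    · by_cases hvn : v ∈ near S a b r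
      · exact ih1 v hvn hvr
      · have hvf := (near_or_far v hv).resolve_left hvn
        obtain ⟨e1, e2⟩ := hleaf v hvf (fun e => hvn (by rw [e]; exact left_mem_near hd.1))
          (fun e => hvn (by rw [e]; exact right_mem_near hd.2.1))
        rw [e2, e1]
    -- A free side of `S` avoids `a` and `b`, which lie in two pieces. Hence it is inherited from
    -- the near half, or both its ends are new vertices of the leaf.
    · have hna : ∀ v, v = a ∨ v = b → ∃ R R', IsPiece D univ R ∧ IsPiece D univ R' ∧ R ⊆ S ∧
          R' ⊆ S ∧ v ∈ R ∧ v ∈ R' ∧ R ≠ R' := by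
        intro v hv
        have hvn : v ∈ near S a b r := by
          rcases hv with hv | hv <;> rw [hv]
          · exact left_mem_near hd.1
          · exact right_mem_near hd.2.1
        have hvf : v ∈ far S a b r := by
          rcases hv with hv | hv <;> rw [hv]
          · exact left_mem_far hd.1
          · exact right_mem_far hd.2.1
        obtain ⟨R, hR, hvR, hs⟩ := hnear.isSubpolygon.exists_isPiece_mem hvn
        exact ⟨R, far S a b r, hR, hp, hs.trans near_subset, far_subset, hvR, hvf,
          ne_of_subset_near_of_subset_far hs Subset.rfl hR.three_le_card⟩
      have hnot : ∀ v, v = x ∨ v = y → v ≠ a ∧ v ≠ b := by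
        intro v hv
        rw [← not_or]
        intro hv'
        obtain ⟨R, R', h1, h2, h3, h4, h5, h6, h7⟩ := hna v hv'
        exact h7 (hone v hv R R' h1 h2 h3 h4 h5 h6)
      have hsub : ({x, y} : Finset (Fin n)) ⊆ S := by
        intro v hv
        simp only [mem_insert, mem_singleton] at hv
        rcases hv with rfl | rfl
        · exact hxy.1
        · exact hxy.2.1
      have hnc : ∀ u ∈ ({x, y} : Finset (Fin n)), ∀ v ∈ ({x, y} : Finset (Fin n)),
          ¬ Crosses a b u v := by
        simp only [mem_insert, mem_singleton]
        have := hxy.2.2.2 a hd.1 b hd.2.1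
        rintro u (rfl | rfl) v (rfl | rfl) hx
        · exact hx.ne.2.1 rfl
        · exact this hx.symm
        · exact this hx.symm.swap
        · exact hx.ne.2.1 rfl
      rcases subset_near_or_far (r := r) hsub hnc with hs | hs
      · refine ih2 x y (hxy.of_subset near_subset (hs (by simp)) (hs (by simp))) hxr hyr ?_
        exact fun v hv R R' h1 h2 h3 h4 => hone v hv R R' h1 h2 (h3.trans near_subset)
          (h4.trans near_subset)
      · rw [(hleaf x (hs (by simp)) (hnot x (.inl rfl)).1 (hnot x (.inl rfl)).2).1,
          (hleaf y (hs (by simp)) (hnot y (.inr rfl)).1 (hnot y (.inr rfl)).2).1]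

end Towers

/-! ### The unitary triangulation from a tower decomposition -/

section TowerTriangulation

open Finset

variable {n : ℕ} {S R Q Q' : Finset (Fin n)} {a b c d i j r v x y z : Fin n} {m : ℕ}
  {D E : SimpleGraph (Fin n)}

theorem IsTower.isRoofed (hQ : IsSubpolygon D Q) (h : IsTower D Q m) (hr : IsRoofPoint D Q r) :
    IsRoofed D Q r where
  isSubpolygon := hQ
  mem := hr.1
  card_piece R hR hRQ := h.card_piece R (hQ.isPiece_iff.2 ⟨hR, hRQ⟩)
  triangle R R' hR hR' hRQ hR'Q h3 h3' := by
    obtain ⟨A, hA⟩ := Set.ncard_eq_one.1 h.triangle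
    have h1 : R ∈ ({A} : Set (Finset (Fin n))) := hA ▸ ⟨hQ.isPiece_iff.2 ⟨hR, hRQ⟩, h3⟩
    have h2 : R' ∈ ({A} : Set (Finset (Fin n))) := hA ▸ ⟨hQ.isPiece_iff.2 ⟨hR', hR'Q⟩, h3'⟩
    exact (Set.mem_singleton_iff.1 h1).trans (Set.mem_singleton_iff.1 h2).symm
  roof R hR hRQ hrR := hr.2 R (hQ.isPiece_iff.2 ⟨hR, hRQ⟩) hrR
  incident v := by
    refine (Set.ncard_le_ncard ?_ (Set.toFinite _)).trans (h.incident v)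
    exact fun R hR => ⟨hQ.isPiece_iff.2 ⟨hR.1, hR.2.1⟩, hR.2.2⟩

/-- Two sides of a triangle of a tower cannot both be glued to other pieces. -/
theorem not_isDiagonal_and_isDiagonal (hQ : IsSubpolygon D Q)
    (hinc : {R | IsPiece D univ R ∧ R ⊆ Q ∧ x ∈ R}.ncard ≤ 2) (hR : IsPiece D univ R) (hRQ : R ⊆ Q)
    (hm : ∀ v, v ∈ R ↔ v = x ∨ v = y ∨ v = z) (hyz : y ≠ z) (hxy : D.Adj x y) (hxz : D.Adj x z)
    (hdy : IsDiagonal Q x y) (hdz : IsDiagonal Q x z) : False := by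
  have hzQ := hdz.2.1
  have hyQ := hdy.2.1
  obtain ⟨R₁, h1, hx1, hs1⟩ :=
    (hQ.far hxy hdy hxz.ne.symm hyz.symm).exists_isPiece_mem (left_mem_far hdy.1)
  obtain ⟨R₂, h2, hx2, hs2⟩ :=
    (hQ.far hxz hdz hxy.ne.symm hyz).exists_isPiece_mem (left_mem_far hdz.1)
  have hn1 : R ⊆ near Q x y z := fun v hv => by
    rcases (hm v).1 hv with hv | hv | hv <;> rw [hv]
    · exact left_mem_near hdy.1
    · exact right_mem_near hyQ
    · exact self_mem_near hzQ
  have hn2 : R ⊆ near Q x z y := fun v hv => by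
    rcases (hm v).1 hv with hv | hv | hv <;> rw [hv]
    · exact left_mem_near hdy.1
    · exact self_mem_near hyQ
    · exact right_mem_near hzQ
  refine not_three_pieces hinc hR h1 h2 hRQ (hs1.trans far_subset) (hs2.trans far_subset)
    ((hm x).2 (.inl rfl)) hx1 hx2 (ne_of_subset_near_of_subset_far hn1 hs1 hR.three_le_card)
    (ne_of_subset_near_of_subset_far hn2 hs2 hR.three_le_card) ?_
  rintro rfl
  obtain ⟨u, hu, hux, huy⟩ := exists_mem_ne_ne h1.three_le_card x y
  have c1 := ((mem_far.1 (hs1 hu)).2.resolve_left hux).resolve_left huy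
  have c2 := ((mem_far.1 (hs2 hu)).2.resolve_left hux).resolve_left c1.ne.2.1.symm
  exact c1.swap.not_crosses_pairing c2.swap

/-- Suppose a piece at `x` has a vertex `y` outside the triangle `R`. The side of `R` that cuts off
`y` is an arc of `D`: it either ends at `x`, and is then a diagonal of `Q` there, or it splits that
piece. -/
theorem isRoofPoint_of_not_isDiagonal (hD : IsDissection D) (hQ : IsSubpolygon D Q)
    (hR : IsPiece D univ R) (hRQ : R ⊆ Q) (h3 : R.card = 3) (hx : x ∈ R)
    (h : ∀ y ∈ R, ¬ IsDiagonal Q x y) : IsRoofPoint D Q x := by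
  refine ⟨hRQ hx, fun A hA hxA => ?_⟩
  obtain ⟨hA, hAQ⟩ := hQ.isPiece_iff.1 hA
  suffices hAR : A ⊆ R from h3 ▸ congrArg card (eq_of_subset_of_card_le hAR (by
    have := hA.three_le_card
    omega))
  intro y hy
  by_contra hyR
  obtain ⟨s, t, u, hs, ht, hst, hu, hc, hsep⟩ := hR.isSubpolygon.exists_adj_separating hyR
  rcases hsep x hx with rfl | rfl | hx'
  · exact h t ht ⟨hRQ hs, hRQ ht, y, hAQ hy, u, hRQ hu, hc⟩
  · exact h s hs ⟨hRQ ht, hRQ hs, y, hAQ hy, u, hRQ hu, hc.swap⟩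
  · exact hA.not_crosses hD hst hy hxA hx'

/-- Any two sides of the triangle share a vertex, so by the incidence bound at most one of them is a
diagonal of `Q`. The vertex opposite to it is a roof point. -/
theorem IsTower.exists_isRoofPoint (hD : IsDissection D) (hQ : IsSubpolygon D Q)
    (h : IsTower D Q m) : ∃ r, IsRoofPoint D Q r := by
  obtain ⟨R, hR'⟩ := Set.ncard_eq_one.1 h.triangle
  have hR : IsPiece D Q R ∧ R.card = 3 := by
    have : R ∈ ({R} : Set (Finset (Fin n))) := rfl
    rwa [← hR'] at this
  obtain ⟨hR, h3⟩ := hR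
  obtain ⟨hR, hRQ⟩ := hQ.isPiece_iff.1 hR
  have hinc : ∀ x, {R | IsPiece D univ R ∧ R ⊆ Q ∧ x ∈ R}.ncard ≤ 2 := fun x => by
    refine (Set.ncard_le_ncard ?_ (Set.toFinite _)).trans (h.incident x)
    exact fun R hR => ⟨hQ.isPiece_iff.2 ⟨hR.1, hR.2.1⟩, hR.2.2⟩
  obtain ⟨x, y, z, hxy, hyz, hm⟩ := exists_eq_of_card_eq_three h3
  have hadj : ∀ p ∈ R, ∀ q ∈ R, IsDiagonal Q p q → D.Adj p q := fun p hp q hq hd => by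
    refine (hR.side p q (isSide_of_not_isDiagonal hp hq hd.ne
      (not_isDiagonal_of_card_eq_three h3))).resolve_left fun hs => ?_
    exact (hd.mono (subset_univ Q)) |> hs.not_isDiagonal
  have key : ∀ p q s, (∀ v, v ∈ R ↔ v = p ∨ v = q ∨ v = s) → q ≠ s → IsDiagonal Q p q →
      ¬ IsDiagonal Q p s := fun p q s hm hqs hpq hps =>
    not_isDiagonal_and_isDiagonal hQ (hinc p) hR hRQ hm hqs
      (hadj p ((hm p).2 (.inl rfl)) q ((hm q).2 (.inr (.inl rfl))) hpq)
      (hadj p ((hm p).2 (.inl rfl)) s ((hm s).2 (.inr (.inr rfl))) hps) hpq hps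
  have roof : ∀ p q s, (∀ v, v ∈ R ↔ v = p ∨ v = q ∨ v = s) → ¬ IsDiagonal Q p q →
      ¬ IsDiagonal Q p s → IsRoofPoint D Q p := fun p q s hm hpq hps =>
    isRoofPoint_of_not_isDiagonal hD hQ hR hRQ h3 ((hm p).2 (.inl rfl)) fun v hv hd => by
      rcases (hm v).1 hv with rfl | rfl | rfl
      · exact hd.ne rfl
      · exact hpq hd
      · exact hps hd
  have hm1 : ∀ v, v ∈ R ↔ v = y ∨ v = z ∨ v = x := fun v => by rw [hm]; tauto
  have hm2 : ∀ v, v ∈ R ↔ v = z ∨ v = x ∨ v = y := fun v => by rw [hm]; tauto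
  have k1 := key x y z hm hyz.ne
  have k2 := key y z x hm1 (hxy.trans hyz).ne'
  have k3 := key z x y hm2 hxy.ne
  have s1 : IsDiagonal Q x y ↔ IsDiagonal Q y x := ⟨.symm, .symm⟩
  have s2 : IsDiagonal Q y z ↔ IsDiagonal Q z y := ⟨.symm, .symm⟩
  have s3 : IsDiagonal Q x z ↔ IsDiagonal Q z x := ⟨.symm, .symm⟩
  by_cases hx : ¬ IsDiagonal Q x y ∧ ¬ IsDiagonal Q x z
  · exact ⟨x, roof x y z hm hx.1 hx.2⟩
  by_cases hy : ¬ IsDiagonal Q y z ∧ ¬ IsDiagonal Q y x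
  · exact ⟨y, roof y z x hm1 hy.1 hy.2⟩
  by_cases hz : ¬ IsDiagonal Q z x ∧ ¬ IsDiagonal Q z y
  · exact ⟨z, roof z x y hm2 hz.1 hz.2⟩
  tauto

/-- A tower with two roof points is a triangle. -/
theorem IsRoofed.not_isDiagonal_of_ne {r' : Fin n} (h : IsRoofed D Q r) (h' : IsRoofed D Q r')
    (hne : r ≠ r') : ¬ IsDiagonal Q a b := by
  obtain ⟨R, hR, hr, hRQ⟩ := h.isSubpolygon.exists_isPiece_mem h.mem
  obtain ⟨R', hR', hr', hRQ'⟩ := h'.isSubpolygon.exists_isPiece_mem h'.mem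
  have h3 := h.roof R hR hRQ hr
  have := h.triangle R R' hR hR' hRQ hRQ' h3 (h'.roof R' hR' hRQ' hr')
  subst this
  -- The triangle `R` contains both roofs. A side of `R` that is a diagonal of `Q` would be an arc
  -- of `D` avoiding both, giving `R` four vertices.
  have : R = Q := by
    refine eq_of_subset_of_isSide hRQ hR.three_le_card fun i j hij => ?_
    rcases hR.side i j hij with hu | hadj
    · exact hu.of_subset (subset_univ Q) (hRQ hij.1) (hRQ hij.2.1)
    · refine isSide_of_not_isDiagonal (hRQ hij.1) (hRQ hij.2.1) hadj.ne fun hd => ?_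
      have := card_four_of_ne hne (h.ne_of_isDiagonal hadj hd)
        (h.ne_of_isDiagonal hadj.symm hd.symm) (h'.ne_of_isDiagonal hadj hd)
        (h'.ne_of_isDiagonal hadj.symm hd.symm) hadj.ne hr hr' hij.1 hij.2.1
      omega
  exact not_isDiagonal_of_card_eq_three (this ▸ h3)

theorem towerTriangulation_adj : (towerTriangulation D E).Adj a b ↔ a ≠ b ∧ (E.Adj a b ∨
    ∃ Q, IsPiece E univ Q ∧ IsDiagonal Q a b ∧ (IsRoofPoint D Q a ∨ IsRoofPoint D Q b)) := by
  rw [towerTriangulation, SimpleGraph.fromRel_adj]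
  refine and_congr_right fun _ => ?_
  constructor
  · rintro ((h | ⟨Q, hQ, hr, hd⟩) | h | ⟨Q, hQ, hr, hd⟩)
    · exact .inl h
    · exact .inr ⟨Q, hQ, hd, .inl hr⟩
    · exact .inl h.symm
    · exact .inr ⟨Q, hQ, hd.symm, .inr hr⟩
  · rintro (h | ⟨Q, hQ, hd, hr | hr⟩)
    · exact .inl (.inl h)
    · exact .inl (.inr ⟨Q, hQ, hr, hd⟩)
    · exact .inr (.inr ⟨Q, hQ, hr, hd.symm⟩)

theorem IsTowerDecomposition.isRoofed (hT : IsTowerDecomposition D E) (hQ : IsPiece E univ Q)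
    (hr : IsRoofPoint D Q r) : IsRoofed D Q r :=
  let ⟨_, hm⟩ := hT.2 Q hQ
  hm.isRoofed (hQ.isSubpolygon.mono hT.1) hr

/-- A gluing arc cannot cross the inside of the piece `Q` of `E`. A crossing tower arc lies in the
same tower and starts at another roof point, so that tower is a triangle and has no diagonals. -/
theorem IsTowerDecomposition.not_crosses_tower_arc (hD : IsDissection D)
    (hT : IsTowerDecomposition D E) (hQ : IsPiece E univ Q) (hr : IsRoofPoint D Q a)
    (hab : IsDiagonal Q a b) (hxy : (towerTriangulation D E).Adj x y) : ¬ Crosses a b x y := by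
  have hE := hT.isDissection hD
  intro hx
  obtain ⟨-, hxy | ⟨Q', hQ', hd, hr'⟩⟩ := towerTriangulation_adj.1 hxy
  · exact hQ.not_crosses hE hxy hab.1 hab.2.1 hx.symm
  · have := hQ'.eq_of_crosses hE hQ hx hab.1 hab.2.1 hd.1 hd.2.1
    subst this
    rcases hr' with hr' | hr'
    · exact (hT.isRoofed hQ hr).not_isDiagonal_of_ne (hT.isRoofed hQ hr') hx.ne.2.2.1 hab
    · exact (hT.isRoofed hQ hr).not_isDiagonal_of_ne (hT.isRoofed hQ hr') hx.ne.2.2.2.1 hab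

theorem IsTowerDecomposition.isDissection_towerTriangulation (hD : IsDissection D)
    (hT : IsTowerDecomposition D E) : IsDissection (towerTriangulation D E) := by
  have hE := hT.isDissection hD
  refine ⟨fun i j hij => ?_, fun i j k l hij hkl hx => ?_⟩
  · obtain ⟨-, h | ⟨Q, hQ, hd, -⟩⟩ := towerTriangulation_adj.1 hij
    · exact hE.1 i j h
    · exact hd.mono (subset_univ Q)
  · obtain ⟨-, h | ⟨Q, hQ, hd, hr | hr⟩⟩ := towerTriangulation_adj.1 hij
    · obtain ⟨-, h' | ⟨Q, hQ, hd, hr⟩⟩ := towerTriangulation_adj.1 hkl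
      · exact hE.2 i j k l h h' hx
      · exact hQ.not_crosses hE h hd.1 hd.2.1 hx
    · exact hT.not_crosses_tower_arc hD hQ hr hd hkl hx
    · exact hT.not_crosses_tower_arc hD hQ hr hd.symm hkl hx.swap

theorem IsTowerDecomposition.le_towerTriangulation : E ≤ towerTriangulation D E := fun _ _ h =>
  towerTriangulation_adj.2 ⟨h.ne, .inl h⟩

theorem IsTowerDecomposition.isTriangulation (hn : 3 ≤ n) (hD : IsDissection D)
    (hT : IsTowerDecomposition D E) : IsTriangulation (towerTriangulation D E) := by
  have hE := hT.isDissection hD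
  have hTri := hT.isDissection_towerTriangulation hD
  refine ⟨hTri, fun R hR => ?_⟩
  obtain ⟨Q, hQ, hRQ, -⟩ := (isSubpolygon_univ (D := E) hn).exists_isPiece (subset_univ R)
    fun i j hij x hx y hy => hR.not_crosses hTri (le_towerTriangulation hij) hx hy
  obtain ⟨m, hm⟩ := hT.2 Q hQ
  obtain ⟨r, hr⟩ := hm.exists_isRoofPoint hD (hQ.isSubpolygon.mono hT.1)
  -- An arc cutting `r` off from `R` would be a gluing arc that splits `Q`, or a tower arc of `Q`
  -- from a second roof point; both are impossible.
  have hrR : r ∈ R := by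
    by_contra hrR
    obtain ⟨s, t, u, hs, ht, hst, hu, hc, -⟩ := hR.isSubpolygon.exists_adj_separating hrR
    obtain ⟨-, h | ⟨Q', hQ', hd, hr'⟩⟩ := towerTriangulation_adj.1 hst
    · exact hQ.not_crosses hE h hr.1 (hRQ hu) hc
    · have := hQ'.eq_of_crosses hE hQ hc.symm hr.1 (hRQ hu) hd.1 hd.2.1
      subst this
      rcases hr' with hr' | hr'
      · exact (hT.isRoofed hQ hr).not_isDiagonal_of_ne (hT.isRoofed hQ hr')
          (fun e => hrR (e ▸ hs)) hd
      · exact (hT.isRoofed hQ hr).not_isDiagonal_of_ne (hT.isRoofed hQ hr')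
          (fun e => hrR (e ▸ ht)) hd
  -- A diagonal of `R` at `r` would be a tower arc, hence an arc of the triangulation inside one of
  -- its own pieces.
  have hside : ∀ v ∈ R, v ≠ r → IsSide R r v := fun v hv hvr =>
    isSide_of_not_isDiagonal hrR hv hvr.symm fun hd => hR.not_adj r v hd
      (towerTriangulation_adj.2 ⟨hvr.symm, .inr ⟨Q, hQ, hd.mono hRQ, .inl hr⟩⟩)
  refine le_antisymm ?_ hR.three_le_card
  by_contra! h4
  have h3 : 2 < (R.erase r).card := by
    rw [card_erase_of_mem hrR]
    omega
  obtain ⟨x, hx, y, hy, z, hz, hxy, hxz, hyz⟩ := two_lt_card.1 h3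
  rw [mem_erase] at hx hy hz
  exact not_three_sides (hside x hx.2 hx.1) (hside y hy.2 hy.1) (hside z hz.2 hz.1) hxy hxz hyz

/-- The inverse is `√2 - 1`. -/
theorem isUnit_one_add_rootTwo : IsUnit (⟨1, 1⟩ : ℤ√2) :=
  IsUnit.of_mul_eq_one (⟨-1, 1⟩ : ℤ√2) (by decide)

theorem IsTowerDecomposition.weight_eq_pow (hD : IsDissection D) {w : Fin n → ℤ√2 × ℤ√2}
    (hw : IsModel D univ w) (hT : IsTowerDecomposition D E) (hQ : IsPiece E univ Q)
    (hr : IsRoofPoint D Q r) (hv : v ∈ Q) (hvr : v ≠ r) :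
    weight w r v = (⟨1, 1⟩ : ℤ√2) ^ crossingNumber D r v :=
  ((hT.isRoofed hQ hr).weights hD hw).1 v hv hvr

theorem IsTowerDecomposition.isUnitaryTriangulation (hn : 3 ≤ n) (hD : IsDissection D)
    {w : Fin n → ℤ√2 × ℤ√2} (hw : IsModel D univ w) (hT : IsTowerDecomposition D E) :
    IsUnitaryTriangulation (weight w) (towerTriangulation D E) := by
  refine ⟨hT.isTriangulation hn hD, fun i j hij => ?_⟩
  obtain ⟨hne, h | ⟨Q, hQ, hd, hr | hr⟩⟩ := towerTriangulation_adj.1 hij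
  · rw [hw.weight_eq_one (.inr (hT.1 h))]
    exact isUnit_one
  · rw [hT.weight_eq_pow hD hw hQ hr hd.2.1 hne.symm]
    exact isUnit_one_add_rootTwo.pow _
  · rw [weight_symm, hT.weight_eq_pow hD hw hQ hr hd.1 hne]
    exact isUnit_one_add_rootTwo.pow _

end TowerTriangulation

end PolygonFrieze

open PolygonFrieze
theorem mainTheorem1 (n : ℕ) [NeZero n] (hn : 3 ≤ n) (D : SimpleGraph (Fin n))
    (hD : IsDissection D) (hT : DecomposesIntoTowers D) :
    ∃ f : Fin n → Fin n → ℤ√2,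
      -- `f` is a frieze over `ℤ[√2]`, and it is the one and only frieze from the dissection `D`
      IsFrieze f ∧
      IsFriezeFromDissection D (fun i j => sqrtTwoToReal (f i j)) ∧
      (∀ g : Fin n → Fin n → ℝ, IsFriezeFromDissection D g →
        ∀ i j, g i j = sqrtTwoToReal (f i j)) ∧
      IsUnitary f ∧
      -- the explicit unitary triangulation from any decomposition into towers
      ∀ E : SimpleGraph (Fin n), IsTowerDecomposition D E →
        IsUnitaryTriangulation f (towerTriangulation D E) ∧
        (∀ i j, E.Adj i j → f i j = 1) ∧
        ∀ Q, IsPiece E Finset.univ Q → ∀ r, IsRoofPoint D Q r → ∀ v ∈ Q, v ≠ r →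
          f r v = (⟨1, 1⟩ : ℤ√2) ^ crossingNumber D r v := by
  obtain ⟨E₀, hE₀⟩ := hT
  have hc : ∀ R, IsPiece D Finset.univ R → R.card = 3 ∨ R.card = 4 := fun R hR =>
    hE₀.card_piece hn hD hR
  have huniv := isSubpolygon_univ (D := D) hn
  obtain ⟨w, hw⟩ := huniv.exists_isModel hD hc
  have hf := hw.isFriezeFromDissection hn hc
  refine ⟨weight w, hw.isFrieze hn, hf, fun g hg i j => ?_,
    ⟨_, hE₀.isUnitaryTriangulation hn hD hw⟩, fun E hE =>
    ⟨hE.isUnitaryTriangulation hn hD hw, fun i j hij => hw.weight_eq_one (.inr (hE.1 hij)),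
      fun Q hQ r hr v hv hvr => hE.weight_eq_pow hD hw hQ hr hv hvr⟩⟩
  exact hg.eqOn hf huniv i (Finset.mem_univ i) j (Finset.mem_univ j)
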